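/- Let $(M,g)$ be a smooth oriented Riemannian manifold of dimension $n+1$ with Levi-Civita connection $\nabla$ and Riemannian volume form $\mathrm{vol}$, and let $\pi:TM\to M$ be its tangent bundle. At $u\in TM$ let $T_uTM=H_u\oplus V_u$ be the splitting into the horizontal space of $\nabla$ and the vertical space $V_u=\ker d\pi_u$, and let $w\mapsto w^h\in H_u$ and $w\mapsto w^v\in V_u$ be the horizontal and vertical lifts of vectors $w\in T_{\pi(u)}M$. On $TM$ consider the following objects. - The mirror endomorphism $B$, with $B(w^h)=w^v$ and $B(w^v)=0$, and its adjoint $B^{\mathrm t}$ for the Sasaki metric, with $B^{\mathrm t}(w^v)=w^h$ and $B^{\mathrm t}(w^h)=0$. - The canonical vertical vector field $\xi_u=u^v$ and the geodesic vector field $S=B^{\mathrm t}\xi$, that is, $S_u=u^h$. - The pull-back $\pi^*\mathrm{vol}$, and the vertical volume form $\pi^{\star}\mathrm{vol}$, which vanishes when one of its arguments is horizontal and satisfies $\pi^{\star}\mathrm{vol}(w_0^v,\dots,w_n^v)=\mathrm{vol}(w_0,\dots,w_n)$. - The $n$-forms $\alpha_n=\xi\lrcorner\pi^{\star}\mathrm{vol}$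 and, for $0\le i\le n$, $$\alpha_i(Y_1,\dots,Y_n)=\frac1{i!\,(n-i)!}\sum_{\sigma\in S_n}\mathrm{sg}(\sigma)\,\alpha_n\bigl(BY_{\sigma(1)},\dots,BY_{\sigma(n-i)},Y_{\sigma(n-i+1)},\dots,Y_{\sigma(n)}\bigr).$$ For a smooth vector field $X$ on $M$, let $\widetilde X$ be its complete lift to $TM$: in the coordinates $(x^j,v^j)$ of $TM$ induced by a chart of $M$ in which $X=X^j\partial_{x^j}$, it is $\widetilde X=X^j\partial_{x^j}+v^j\frac{\partial X^k}{\partial x^j}\partial_{v^k}$. **Theorem.** Let $X$ be a Killing vector field on $M$, that is, $X$ is smooth and $\mathcal L_Xg=0$. Then all the objects above are smooth, and: (i) $\mathcal L_{\widetilde X}B^{\mathrm t}=0$ and $\mathcal L_{\widetilde X}B=0$; (ii) $\mathcal L_{\widetilde X}\pi^*\mathrm{vol}=0$ and $\mathcal L_{\widetilde X}\pi^{\star}\mathrm{vol}=0$; (iii) $\mathcal L_{\widetilde X}S=[\widetilde X,S]=0$ and $\mathcal L_{\widetilde X}\xi=[\widetilde X,\xi]=0$; (iv) $\mathcal L_{\widetilde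 X}\alpha_i=0$ for all $0\le i\le n$, both on $TM$ and on the unit tangent sphere bundle $SM=\{u\in TM:\|u\|=1\}$, to which $\widetilde X$ is tangent. -/

import Mathlib

open Manifold Filter
open scoped Topology ContDiff

namespace TangentLift

noncomputable section

/-! ## Lie derivatives on a manifold -/

section LieDerivative

variable {E : Type*} [NormedAddCommGroup E] [NormedSpace ℝ E]
  {H : Type*} [TopologicalSpace H] (I : ModelWithCorners ℝ E H)
  {N : Type*} [TopologicalSpace N] [ChartedSpace H N]

/-- The (possibly only locally meaningful) vector field `Y` is smooth at the point `p`. -/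
def SmoothFieldAt [IsManifold I 1 N] (Y : ∀ q : N, TangentSpace I q) (p : N) : Prop :=
  ContMDiffAt I I.tangent ∞ (fun q => (⟨q, Y q⟩ : TangentBundle I N)) p

/-- A field of endomorphisms of the tangent spaces is smooth: it sends smooth vector fields to
smooth vector fields. -/
def SmoothEndo [IsManifold I 1 N] (A : ∀ q : N, TangentSpace I q →ₗ[ℝ] TangentSpace I q) : Prop :=
  ∀ (p : N) (Y : ∀ q : N, TangentSpace I q), SmoothFieldAt I Y p →
    SmoothFieldAt I (fun q => A q (Y q)) p

/-- A differential `k`-form is smooth: its values on smooth vector fields are smooth functions. -/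
def SmoothForm [IsManifold I 1 N] {k : ℕ} (η : ∀ q : N, TangentSpace I q [⋀^Fin k]→ₗ[ℝ] ℝ) : Prop :=
  ∀ (p : N) (Y : Fin k → ∀ q : N, TangentSpace I q), (∀ j, SmoothFieldAt I (Y j) p) →
    ContMDiffAt I 𝓘(ℝ, ℝ) ∞ (fun q => η q (fun j => Y j q)) p

/-- The Lie derivative of a field `A` of endomorphisms, evaluated on a vector field:
`(𝓛_X A) Y = [X, A Y] - A [X, Y]`. -/
def lieDerivEndo (X : ∀ q : N, TangentSpace I q)
    (A : ∀ q : N, TangentSpace I q →ₗ[ℝ] TangentSpace I q)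
    (Y : ∀ q : N, TangentSpace I q) (p : N) : TangentSpace I p :=
  VectorField.mlieBracket I X (fun q => A q (Y q)) p - A p (VectorField.mlieBracket I X Y p)

/-- The Lie derivative of a `k`-form `η`, evaluated on vector fields:
`(𝓛_X η)(Y₁, …, Y_k) = X (η(Y₁, …, Y_k)) - ∑ⱼ η(Y₁, …, [X, Yⱼ], …, Y_k)`. -/
def lieDerivForm {k : ℕ} (X : ∀ q : N, TangentSpace I q)
    (η : ∀ q : N, TangentSpace I q [⋀^Fin k]→ₗ[ℝ] ℝ)
    (Y : Fin k → ∀ q : N, TangentSpace I q) (p : N) : ℝ :=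
  mvfderiv I (fun q => η q (fun j => Y j q)) p (X p)
    - ∑ j, η p (Function.update (fun l => Y l p) j (VectorField.mlieBracket I X (Y j) p))

/-- `𝓛_X A = 0` for a field `A` of endomorphisms. -/
def LieEndoVanishes [IsManifold I 1 N] (X : ∀ q : N, TangentSpace I q)
    (A : ∀ q : N, TangentSpace I q →ₗ[ℝ] TangentSpace I q) : Prop :=
  ∀ (p : N) (Y : ∀ q : N, TangentSpace I q), SmoothFieldAt I Y p → lieDerivEndo I X A Y p = 0

/-- `𝓛_X η = 0` for a differential form `η`. -/
def LieFormVanishes [IsManifold I 1 N] {k : ℕ} (X : ∀ q : N, TangentSpace I q)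
    (η : ∀ q : N, TangentSpace I q [⋀^Fin k]→ₗ[ℝ] ℝ) : Prop :=
  ∀ (p : N) (Y : Fin k → ∀ q : N, TangentSpace I q), (∀ j, SmoothFieldAt I (Y j) p) →
    lieDerivForm I X η Y p = 0

end LieDerivative

/-! ## Christoffel symbols from the derivative of the metric coefficients -/

section Christoffel

variable {E : Type*} [NormedAddCommGroup E] [NormedSpace ℝ E]

/-- The derivative at `y` of a field `g` of bilinear forms on an open set of `E`:
`bilinDeriv g y c a b = ∂_c g(a, b)`. -/
def bilinDeriv (g : E → E →L[ℝ] E →L[ℝ] ℝ) (y : E) : E →L[ℝ] E →L[ℝ] E →L[ℝ] ℝ :=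
  fderiv ℝ g y

/-- The Levi-Civita Christoffel symbols of the first kind, for `G c a b = ∂_c g(a, b)`:
`g(Γ(a, b), c) = (∂_a g(b, c) + ∂_b g(a, c) - ∂_c g(a, b)) / 2`. -/
def christoffelFirst (G : E →L[ℝ] E →L[ℝ] E →L[ℝ] ℝ) (a b c : E) : ℝ :=
  (1 / 2) * (G a b c + G b a c - G c a b)

/-- The vector `Γ(a, b)` determined by `christoffelFirst`, as its expansion in a basis `e` which is
orthonormal for the metric; it is bilinear in `(a, b)`. -/
def christoffelOf {ι : Type*} [Fintype ι] (G : E →L[ℝ] E →L[ℝ] E →L[ℝ] ℝ) (e : ι → E) :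
    E →ₗ[ℝ] E →ₗ[ℝ] E :=
  LinearMap.mk₂ ℝ (fun a b => ∑ k, christoffelFirst G a b (e k) • e k)
    (fun a a' b => by
      simp only [christoffelFirst, map_add, add_apply, ← Finset.sum_add_distrib, ← add_smul]
      exact Finset.sum_congr rfl fun k _ => by ring_nf)
    (fun c a b => by
      simp only [christoffelFirst, map_smul, smul_apply, smul_eq_mul, Finset.smul_sum, smul_smul]
      exact Finset.sum_congr rfl fun k _ => by ring_nf)
    (fun a b b' => by
      simp only [christoffelFirst, map_add, add_apply, ← Finset.sum_add_distrib, ← add_smul]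
      exact Finset.sum_congr rfl fun k _ => by ring_nf)
    (fun c a b => by
      simp only [christoffelFirst, map_smul, smul_apply, smul_eq_mul, Finset.smul_sum, smul_smul]
      exact Finset.sum_congr rfl fun k _ => by ring_nf)

end Christoffel

/-! ## Oriented Riemannian manifolds of dimension `n + 1` -/

section Base

open Bundle

variable (n : ℕ) (E : Type*) [NormedAddCommGroup E] [NormedSpace ℝ E] [FiniteDimensional ℝ E]
  [Fact (Module.finrank ℝ E = n + 1)]
  (M : Type*) [TopologicalSpace M] [ChartedSpace E M] [IsManifold 𝓘(ℝ, E) ∞ M]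

/-- An orientation of `M`: a pointwise orientation of the tangent spaces such that every point lies
in the domain of a smooth positively oriented local frame. -/
structure ManifoldOrientation where
  /-- the orientation of the tangent space at each point -/
  atPoint : ∀ x : M, Orientation ℝ (TangentSpace 𝓘(ℝ, E) x) (Fin (n + 1))
  /-- around every point there is a smooth positively oriented frame -/
  exists_frame : ∀ x₀ : M, ∃ s : Fin (n + 1) → ∀ x : M, TangentSpace 𝓘(ℝ, E) x,
    (∀ j, SmoothFieldAt 𝓘(ℝ, E) (s j) x₀) ∧
    ∀ᶠ x in 𝓝 x₀, ∃ b : Module.Basis (Fin (n + 1)) ℝ (TangentSpace 𝓘(ℝ, E) x),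
      (∀ j, b j = s j x) ∧ b.orientation = atPoint x

variable {n E M}

instance factFinrankTangentSpace (x : M) :
    Fact (Module.finrank ℝ (TangentSpace 𝓘(ℝ, E) x) = n + 1) :=
  inferInstanceAs (Fact (Module.finrank ℝ E = n + 1))

instance finiteDimensionalTangentSpace (x : M) : FiniteDimensional ℝ (TangentSpace 𝓘(ℝ, E) x) :=
  inferInstanceAs (FiniteDimensional ℝ E)

variable [RiemannianBundle (fun x : M => TangentSpace 𝓘(ℝ, E) x)]

/-- The Riemannian volume form of the oriented manifold `M`. -/
def volForm (o : ManifoldOrientation n E M) (x : M) :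
    TangentSpace 𝓘(ℝ, E) x [⋀^Fin (n + 1)]→ₗ[ℝ] ℝ :=
  (o.atPoint x).volumeForm

/-- `X` is a Killing vector field: `X` is smooth and `𝓛_X g = 0`, that is,
`X ⟨Y, Z⟩ = ⟨[X, Y], Z⟩ + ⟨Y, [X, Z]⟩` for all vector fields `Y`, `Z`. -/
def IsKilling (X : ∀ x : M, TangentSpace 𝓘(ℝ, E) x) : Prop :=
  (∀ x, SmoothFieldAt 𝓘(ℝ, E) X x) ∧
  ∀ (x : M) (Y Z : ∀ y : M, TangentSpace 𝓘(ℝ, E) y),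
    SmoothFieldAt 𝓘(ℝ, E) Y x → SmoothFieldAt 𝓘(ℝ, E) Z x →
    mvfderiv 𝓘(ℝ, E) (fun y => inner ℝ (Y y) (Z y)) x (X x) =
      inner ℝ (VectorField.mlieBracket 𝓘(ℝ, E) X Y x) (Z x) +
      inner ℝ (Y x) (VectorField.mlieBracket 𝓘(ℝ, E) X Z x)

/-! ### The Levi-Civita connection

In Mathlib a vector of `TangentSpace 𝓘(ℝ, E) x` *is* its vector of components (an element of `E`)
in the preferred chart at `x`.  The Christoffel symbols at `x` below are those of that chart. -/

/-- The coefficients of the metric in the preferred chart at `x₀`, as a function of the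
coordinates `y`, valued in bilinear forms. -/
def metricInChart (x₀ : M) (y : E) : E →L[ℝ] E →L[ℝ] ℝ :=
  (innerSL ℝ : TangentSpace 𝓘(ℝ, E) ((extChartAt 𝓘(ℝ, E) x₀).symm y) →L[ℝ]
      TangentSpace 𝓘(ℝ, E) ((extChartAt 𝓘(ℝ, E) x₀).symm y) →L[ℝ] ℝ).bilinearComp
    ((trivializationAt E (TangentSpace 𝓘(ℝ, E)) x₀).symmL ℝ ((extChartAt 𝓘(ℝ, E) x₀).symm y))
    ((trivializationAt E (TangentSpace 𝓘(ℝ, E)) x₀).symmL ℝ ((extChartAt 𝓘(ℝ, E) x₀).symm y))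

/-- The Christoffel symbols at `x`, in the preferred chart at `x`, of the Levi-Civita connection:
`Γ(a, b)` is the vector with components `Γᵢⱼᵏ aⁱ bʲ`. The choice of orthonormal basis of
the tangent space is irrelevant. -/
def christoffel (x : M) :
    TangentSpace 𝓘(ℝ, E) x →ₗ[ℝ] TangentSpace 𝓘(ℝ, E) x →ₗ[ℝ] TangentSpace 𝓘(ℝ, E) x :=
  (christoffelOf (bilinDeriv (metricInChart x) (extChartAt 𝓘(ℝ, E) x x))
    (fun k => (stdOrthonormalBasis ℝ (TangentSpace 𝓘(ℝ, E) x) k : TangentSpace 𝓘(ℝ, E) x)) :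
    E →ₗ[ℝ] E →ₗ[ℝ] E)

end Base

/-! ## The tangent manifold `TM`

Its points are `p = (x, v)` with `x = p.proj` and `v = p.2`. The chart of `M` at `x` induces the chart
`(xʲ, vʲ)` of `TM` at `p`; in Mathlib a vector of `TangentSpace 𝓘(ℝ, E).tangent p` *is* the pair
`(a, b)` of its components in that chart, i.e. the vector `aʲ ∂/∂xʲ + bʲ ∂/∂vʲ`. -/

section TangentManifold

open Bundle

variable {n : ℕ} {E : Type*} [NormedAddCommGroup E] [NormedSpace ℝ E] [FiniteDimensional ℝ E]
  [Fact (Module.finrank ℝ E = n + 1)]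
  {M : Type*} [TopologicalSpace M] [ChartedSpace E M] [IsManifold 𝓘(ℝ, E) ∞ M]

/-- The differential `dπ` of the projection `π : TM → M`: `(a, b) ↦ a`. -/
def dProj (p : TangentBundle 𝓘(ℝ, E) M) :
    TangentSpace 𝓘(ℝ, E).tangent p →ₗ[ℝ] TangentSpace 𝓘(ℝ, E) p.proj :=
  (LinearMap.fst ℝ E E : E × E →ₗ[ℝ] E)

/-- `dProj` is the differential of the bundle projection. -/
theorem mfderiv_proj_eq (p : TangentBundle 𝓘(ℝ, E) M) (ζ : TangentSpace 𝓘(ℝ, E).tangent p) :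
    mfderiv 𝓘(ℝ, E).tangent 𝓘(ℝ, E) (TotalSpace.proj : TangentBundle 𝓘(ℝ, E) M → M) p ζ
      = dProj p ζ := by
  have h : HasMFDerivAt 𝓘(ℝ, E).tangent 𝓘(ℝ, E) (TotalSpace.proj : TangentBundle 𝓘(ℝ, E) M → M) p
      (ContinuousLinearMap.fst ℝ E E : E × E →L[ℝ] E) := by
    refine ⟨(FiberBundle.continuous_proj E _).continuousAt, ?_⟩
    have key : ∀ y ∈ (extChartAt 𝓘(ℝ, E).tangent p).target,
        writtenInExtChartAt 𝓘(ℝ, E).tangent 𝓘(ℝ, E) p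
          (TotalSpace.proj : TangentBundle 𝓘(ℝ, E) M → M) y = Prod.fst y := fun y hy =>
      congrArg Prod.fst ((extChartAt 𝓘(ℝ, E).tangent p).right_inv hy)
    refine HasFDerivWithinAt.congr_of_eventuallyEq (f := Prod.fst) hasFDerivWithinAt_fst ?_
      (key _ (mem_extChartAt_target p))
    filter_upwards [extChartAt_target_mem_nhdsWithin (I := 𝓘(ℝ, E).tangent) p] with y hy
      using key y hy
  rw [h.mfderiv]; rfl

/-- The vertical lift `π^⋆` of a vector of `M`: `b ↦ (0, b)`. -/
def vertLift (p : TangentBundle 𝓘(ℝ, E) M) :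
    TangentSpace 𝓘(ℝ, E) p.proj →ₗ[ℝ] TangentSpace 𝓘(ℝ, E).tangent p :=
  (LinearMap.inr ℝ E E : E →ₗ[ℝ] E × E)

/-- The mirror endomorphism `B = dxʲ ⊗ ∂/∂vʲ` of the tangent bundle of `TM`: it sends `(a, b)` to
`(0, a)`. -/
def mirror (p : TangentBundle 𝓘(ℝ, E) M) :
    TangentSpace 𝓘(ℝ, E).tangent p →ₗ[ℝ] TangentSpace 𝓘(ℝ, E).tangent p :=
  vertLift p ∘ₗ dProj p

/-- The canonical vertical vector field `ξ` on `TM`, `ξ_u = u` (lifted vertically). -/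
def canonicalField (p : TangentBundle 𝓘(ℝ, E) M) : TangentSpace 𝓘(ℝ, E).tangent p :=
  vertLift p p.2

/-- The complete lift (extended vector field) `X̃ = Xʲ ∂/∂xʲ + vʲ (∂Xᵏ/∂xʲ) ∂/∂vᵏ` of a vector field
`X` on `M`. -/
def completeLift (X : ∀ x : M, TangentSpace 𝓘(ℝ, E) x) (p : TangentBundle 𝓘(ℝ, E) M) :
    TangentSpace 𝓘(ℝ, E).tangent p :=
  ((X p.proj,
    fderiv ℝ (fun y : E => (trivializationAt E (TangentSpace 𝓘(ℝ, E)) p.proj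
        ⟨(extChartAt 𝓘(ℝ, E) p.proj).symm y, X ((extChartAt 𝓘(ℝ, E) p.proj).symm y)⟩).2)
      (extChartAt 𝓘(ℝ, E) p.proj p.proj) p.2) : E × E)

variable [RiemannianBundle (fun x : M => TangentSpace 𝓘(ℝ, E) x)]

/-- The horizontal lift `π^*` of a vector of `M`: `a ↦ (a, -Γ(a, v))`. -/
def horLift (p : TangentBundle 𝓘(ℝ, E) M) :
    TangentSpace 𝓘(ℝ, E) p.proj →ₗ[ℝ] TangentSpace 𝓘(ℝ, E).tangent p :=
  (LinearMap.prod LinearMap.id (-(christoffel p.proj).flip p.2) : E →ₗ[ℝ] E × E)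

/-- The connection map `K : (a, b) ↦ b + Γ(a, v)`, that is `ζ ↦ ∇^*_ζ ξ` as a vector of `M`. It
inverts the vertical lift, and its kernel is the horizontal distribution. -/
def connMap (p : TangentBundle 𝓘(ℝ, E) M) :
    TangentSpace 𝓘(ℝ, E).tangent p →ₗ[ℝ] TangentSpace 𝓘(ℝ, E) p.proj :=
  (LinearMap.coprod ((christoffel p.proj).flip p.2) LinearMap.id : E × E →ₗ[ℝ] E)

/-- The Sasaki metric of `TM`. -/
def sasaki (p : TangentBundle 𝓘(ℝ, E) M) (ζ ζ' : TangentSpace 𝓘(ℝ, E).tangent p) : ℝ :=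
  inner ℝ (dProj p ζ) (dProj p ζ') + inner ℝ (connMap p ζ) (connMap p ζ')

/-- The adjoint `Bᵗ` of the mirror endomorphism for the Sasaki metric: it sends the vertical lift of
a vector to its horizontal lift, and horizontal vectors to `0`. -/
def mirrorAdjoint (p : TangentBundle 𝓘(ℝ, E) M) :
    TangentSpace 𝓘(ℝ, E).tangent p →ₗ[ℝ] TangentSpace 𝓘(ℝ, E).tangent p :=
  horLift p ∘ₗ connMap p

/-- `Bᵗ` is the adjoint of `B` for the Sasaki metric. -/
theorem sasaki_mirror (p : TangentBundle 𝓘(ℝ, E) M) (ζ ζ') :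
    sasaki p (mirror p ζ) ζ' = sasaki p ζ (mirrorAdjoint p ζ') := by
  have h1 : dProj p (mirror p ζ) = 0 := rfl
  have h2 : dProj p (mirrorAdjoint p ζ') = connMap p ζ' := rfl
  have h3 : connMap p (mirror p ζ) = dProj p ζ := by
    change (christoffel p.proj 0 p.2 + dProj p ζ) = _
    simp
  have h4 : connMap p (mirrorAdjoint p ζ') = 0 := by
    change christoffel p.proj (connMap p ζ') p.2 + - christoffel p.proj (connMap p ζ') p.2 = _
    simp
  simp only [sasaki, h1, h2, h3, h4]
  erw [inner_zero_left, inner_zero_right, zero_add, add_zero]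

/-- The geodesic flow vector field `S = Bᵗ ξ` on `TM`. -/
def geodesicField (p : TangentBundle 𝓘(ℝ, E) M) : TangentSpace 𝓘(ℝ, E).tangent p :=
  mirrorAdjoint p (canonicalField p)

/-- The pull-back `π^* vol` of the volume form of `M` to `TM`. -/
def horVol (o : ManifoldOrientation n E M) (p : TangentBundle 𝓘(ℝ, E) M) :
    TangentSpace 𝓘(ℝ, E).tangent p [⋀^Fin (n + 1)]→ₗ[ℝ] ℝ :=
  (volForm o p.proj).compLinearMap (dProj p)

/-- The vertical volume form `π^⋆ vol` on `TM`: it vanishes if one of its arguments is horizontal,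
and takes the value `vol(w₀, …, wₙ)` on the vertical lifts of `w₀, …, wₙ`. -/
def vertVol (o : ManifoldOrientation n E M) (p : TangentBundle 𝓘(ℝ, E) M) :
    TangentSpace 𝓘(ℝ, E).tangent p [⋀^Fin (n + 1)]→ₗ[ℝ] ℝ :=
  (volForm o p.proj).compLinearMap (connMap p)

/-- The `n`-form `αₙ = ξ ⌟ π^⋆ vol` on `TM`. On the unit tangent sphere bundle it is the volume form
of the fibres. -/
def alphaTop (o : ManifoldOrientation n E M) (p : TangentBundle 𝓘(ℝ, E) M) :
    TangentSpace 𝓘(ℝ, E).tangent p [⋀^Fin n]→ₗ[ℝ] ℝ :=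
  (vertVol o p).curryLeft (canonicalField p)

/-- The alternating operator `η ∘ (A₁ ∧ ⋯ ∧ A_k)` for a `k`-form `η` and endomorphisms `A₁, …, A_k`:
it maps `(Y₁, …, Y_k)` to `∑_σ sg(σ) η(A₁ Y_{σ 1}, …, A_k Y_{σ k})`. -/
def altComp {V : Type*} [AddCommGroup V] [Module ℝ V] {k : ℕ} (η : V [⋀^Fin k]→ₗ[ℝ] ℝ)
    (A : Fin k → V →ₗ[ℝ] V) : V [⋀^Fin k]→ₗ[ℝ] ℝ :=
  MultilinearMap.alternatization (η.toMultilinearMap.compLinearMap A)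

theorem altComp_apply {V : Type*} [AddCommGroup V] [Module ℝ V] {k : ℕ}
    (η : V [⋀^Fin k]→ₗ[ℝ] ℝ) (A : Fin k → V →ₗ[ℝ] V) (Y : Fin k → V) :
    altComp η A Y = ∑ σ : Equiv.Perm (Fin k), Equiv.Perm.sign σ • η (fun j => A j (Y (σ j))) := by
  simp [altComp, MultilinearMap.alternatization_apply]

/-- The `n`-forms `αᵢ = (1 / (i! (n - i)!)) αₙ ∘ (B^{n-i} ∧ 1^i)` on `TM`, for `0 ≤ i ≤ n`. -/
def alpha (o : ManifoldOrientation n E M) (i : ℕ) (p : TangentBundle 𝓘(ℝ, E) M) :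
    TangentSpace 𝓘(ℝ, E).tangent p [⋀^Fin n]→ₗ[ℝ] ℝ :=
  (1 / ((i.factorial : ℝ) * ((n - i).factorial : ℝ))) •
    altComp (alphaTop o p) (fun j => if (j : ℕ) < n - i then mirror p else LinearMap.id)

/-! ### The unit tangent sphere bundle `SM` -/

/-- The function `(x, v) ↦ ⟨v, v⟩` on `TM`. -/
def normSq (p : TangentBundle 𝓘(ℝ, E) M) : ℝ := inner ℝ p.2 p.2

/-- The tangent vector `ζ` of `TM` is tangent to the sphere bundle of constant norm through its base
point. -/
def TangentToSphere (p : TangentBundle 𝓘(ℝ, E) M) (ζ : TangentSpace 𝓘(ℝ, E).tangent p) : Prop :=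
  mvfderiv 𝓘(ℝ, E).tangent (normSq (E := E) (M := M)) p ζ = 0

/-- `𝓛_X η = 0` on the unit tangent sphere bundle `SM = {⟨v, v⟩ = 1}`, for a vector field `X` which
is tangent to `SM` and the restriction to `SM` of a form `η`. A vector field on `SM` is given locally
as the restriction of a vector field on `TM` which is tangent to `SM` along `SM`. -/
def LieFormVanishesOnSphere {k : ℕ}
    (X : ∀ p : TangentBundle 𝓘(ℝ, E) M, TangentSpace 𝓘(ℝ, E).tangent p)
    (η : ∀ p : TangentBundle 𝓘(ℝ, E) M, TangentSpace 𝓘(ℝ, E).tangent p [⋀^Fin k]→ₗ[ℝ] ℝ) : Prop :=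
  (∀ u : TangentBundle 𝓘(ℝ, E) M, normSq u = 1 → TangentToSphere u (X u)) ∧
  ∀ u : TangentBundle 𝓘(ℝ, E) M, normSq u = 1 →
    ∀ Y : Fin k → ∀ p : TangentBundle 𝓘(ℝ, E) M, TangentSpace 𝓘(ℝ, E).tangent p,
      (∀ j, SmoothFieldAt 𝓘(ℝ, E).tangent (Y j) u) →
      (∀ j, ∀ᶠ p in 𝓝 u, normSq p = 1 → TangentToSphere p (Y j p)) →
      lieDerivForm 𝓘(ℝ, E).tangent X η Y u = 0

end TangentManifold

end

end TangentLift

open Bundle TangentLift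

/-! The flow of a Killing field consists of orientation-preserving local isometries, and their
differentials are the flow of the complete lift. They preserve every object of `TM` built from the
metric, the orientation and the tangent structure. The proof is the infinitesimal form of this
remark, computed in charts and without flows.

Three facts carry it. (1) In coordinates the lift is `(X, DX v)`: it is linear in the fibre and acts
to first order by `DX` on both factors. Hence it commutes with `B` and `ξ` for every smooth `X`
(`lieBracket_coordMirror`, `lieBracket_coordCanonical`). (2) `Bᵗ` involves the Christoffel symbols.
Differentiating the Killing equation once and taking the Koszul combination of its permutations
gives `X·Γ(a,b) = DX Γ(a,b) - Γ(DX a,b) - Γ(a,DX b) - D²X(a,b)`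
(`fderiv_christoffelSecond_of_killing`). This is precisely the identity under which bracketing with
the lift commutes with `Bᵗ` (`lieBracket_coordMirrorAdjoint`). (3) The square of the volume form is
a Gram determinant. Its entries are stationary along `X` by the Killing equation, and the volume
does not vanish on a basis, so the volume itself is stationary (`fderiv_volume_of_killing`).

The rest is formal, since the Lie derivative is a derivation: `dπ ∘ Bᵗ` is the connection map, so
`π^⋆ vol` is `π^* vol` composed with `Bᵗ`; `S = Bᵗ ξ`; `αₙ` is a contraction with `ξ`; and `αᵢ`
alternates `αₙ` composed with copies of `B` and `1`. Tangency to `SM` holds because the derivative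
of `⟨v, v⟩` along the lift is `(𝓛_X g)(v, v)`.

A tangent vector at `q` is stored by its components in the chart preferred at `q`, so a field near
`p` must first be moved into the single chart at `p`. On `TM` this change is `(a, b) ↦ (Dτ a, D²τ(a,
v) + Dτ b)`, and its second-order term is matched by the inhomogeneous term in the transformation
law of `Γ`. Likewise the Killing equation is obtained at chart centres, then transported to a
neighbourhood in one chart. -/

namespace TangentLift

set_option maxSynthPendingDepth 3

noncomputable section

open Bundle

/-! ### Smoothness, derivatives and Lie brackets read in a preferred chart -/

section Charts

variable {E : Type*} [NormedAddCommGroup E] [NormedSpace ℝ E]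
  {H : Type*} [TopologicalSpace H] (I : ModelWithCorners ℝ E H)
  {N : Type*} [TopologicalSpace N] [ChartedSpace H N] [IsManifold I 1 N]

/-- The components of the vector field `Y` in the preferred chart at `p`, as a function of the
coordinates. -/
def coordField (p : N) (Y : ∀ q : N, TangentSpace I q) (z : E) : E :=
  tangentCoordChange I ((extChartAt I p).symm z) p ((extChartAt I p).symm z)
    (Y ((extChartAt I p).symm z))

theorem coordField_self (p : N) (Y : ∀ q : N, TangentSpace I q) :
    coordField I p Y (extChartAt I p p) = Y p := by
  unfold coordField
  rw [extChartAt_to_inv]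
  exact tangentCoordChange_self (mem_extChartAt_source p)

variable [I.Boundaryless]

omit [IsManifold I 1 N] in
theorem contMDiffAt_iff_contDiffAt_symm {F : Type*} [NormedAddCommGroup F] [NormedSpace ℝ F]
    (f : N → F) (p : N) :
    ContMDiffAt I 𝓘(ℝ, F) ∞ f p ↔
      ContDiffAt ℝ ∞ (f ∘ (extChartAt I p).symm) (extChartAt I p p) := by
  rw [contMDiffAt_iff]
  simp only [extChartAt_model_space_eq_id, I.range_eq_univ, contDiffWithinAt_univ]
  refine ⟨fun h => h.2, fun h => ⟨?_, h⟩⟩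
  have h1 : ContinuousAt ((f ∘ (extChartAt I p).symm) ∘ extChartAt I p) p :=
    ContinuousAt.comp h.continuousAt (continuousAt_extChartAt p)
  refine h1.congr ?_
  filter_upwards [extChartAt_source_mem_nhds (I := I) p] with q hq
  exact congrArg f ((extChartAt I p).left_inv hq)

theorem smoothFieldAt_iff (Y : ∀ q : N, TangentSpace I q) (p : N) :
    SmoothFieldAt I Y p ↔ ContDiffAt ℝ ∞ (coordField I p Y) (extChartAt I p p) :=
  (Bundle.contMDiffAt_section p).trans (contMDiffAt_iff_contDiffAt_symm I _ p)

omit [IsManifold I 1 N] in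
theorem mvfderiv_eq_fderiv {F : Type*} [NormedAddCommGroup F] [NormedSpace ℝ F]
    {f : N → F} {p : N} (hf : ContMDiffAt I 𝓘(ℝ, F) ∞ f p) (w : TangentSpace I p) :
    mvfderiv I f p w = fderiv ℝ (f ∘ (extChartAt I p).symm) (extChartAt I p p) w := by
  have h := hf.mdifferentiableAt (by simp)
  have h1 : ∀ A : E →L[ℝ] F, mfderiv I 𝓘(ℝ, F) f p = A → mvfderiv I f p w = A w :=
    fun A hA => DFunLike.congr_fun hA w
  rw [h1 _ h.mfderiv, I.range_eq_univ, fderivWithin_univ]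
  rfl

omit [I.Boundaryless] in
-- The pull-back applies the inverse of the derivative of the inverse chart. That inverse is the
-- derivative of the chart, which is also the coordinate change of the tangent bundle.
theorem mpullbackWithin_extChartAt_symm (p : N) (Y : ∀ q : N, TangentSpace I q) {z : E}
    (hz : z ∈ (extChartAt I p).target) :
    VectorField.mpullbackWithin 𝓘(ℝ, E) I (extChartAt I p).symm Y (Set.range I) z =
      coordField I p Y z := by
  have hx : (extChartAt I p).symm z ∈ (extChartAt I p).source := (extChartAt I p).map_target hz
  have hx' : (extChartAt I p).symm z ∈ (chartAt H p).source := by rwa [← extChartAt_source I]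
  have h1 := TangentBundle.continuousLinearMapAt_trivializationAt (I := I) hx'
  rw [TangentBundle.continuousLinearMapAt_trivializationAt_eq_core hx'] at h1
  rw [VectorField.mpullbackWithin_apply, coordField]
  change _ = ((tangentBundleCore I N).coordChange _ _ _) _
  rw [h1]
  congr 1
  have h2 := mfderivWithin_extChartAt_symm_comp_mfderiv_extChartAt (I := I) hz
  have h3 := mfderiv_extChartAt_comp_mfderivWithin_extChartAt_symm (I := I) hz
  exact ContinuousLinearMap.inverse_eq h2 h3


/-- The manifold bracket is the bracket of the two pulled-back fields, brought back by the inverse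
derivative of the chart at `p`. In the chart preferred at `p` that derivative is the identity, so
only the bracket in the vector space remains. -/
theorem mlieBracket_eq_lieBracket_coordField (X Y : ∀ q : N, TangentSpace I q) (p : N) :
    VectorField.mlieBracket I X Y p =
      VectorField.lieBracket ℝ (coordField I p X) (coordField I p Y) (extChartAt I p p) := by
  rw [← VectorField.mlieBracketWithin_univ, VectorField.mlieBracketWithin_apply]
  have hid : ∀ (A : E →L[ℝ] E) (v : E), A = ContinuousLinearMap.id ℝ E → A.inverse v = v := by
    rintro A v rfl
    simp
  refine (hid _ _ mfderiv_extChartAt_self).trans ?_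
  have h : ∀ Z : (∀ q : N, TangentSpace I q),
      VectorField.mpullbackWithin 𝓘(ℝ, E) I (extChartAt I p).symm Z (Set.range I)
        =ᶠ[𝓝 (extChartAt I p p)] coordField I p Z := fun Z => by
    filter_upwards [extChartAt_target_mem_nhds (I := I) p] with z hz
    exact mpullbackWithin_extChartAt_symm I p Z hz
  have hs : (extChartAt I p).symm ⁻¹' Set.univ ∩ Set.range I = Set.univ := by
    simp [I.range_eq_univ]
  have key : ∀ (V W V' W' : E → E) (s : Set E) (z : E), s = Set.univ → V =ᶠ[𝓝 z] V' →
      W =ᶠ[𝓝 z] W' → VectorField.lieBracketWithin ℝ V W s z = VectorField.lieBracket ℝ V' W' z := by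
    rintro V W V' W' s z rfl hV hW
    rw [VectorField.lieBracketWithin_univ]
    exact Filter.EventuallyEq.lieBracket_vectorField_eq hV hW
  exact key _ _ _ _ _ _ hs (h X) (h Y)

end Charts

/-! ### Transition maps of `M` and of its tangent bundle -/

section Transition

variable {E : Type*} [NormedAddCommGroup E] [NormedSpace ℝ E]
  {M : Type*} [TopologicalSpace M] [ChartedSpace E M] [IsManifold 𝓘(ℝ, E) ∞ M]

/-- The transition map from the preferred chart at `x` to the preferred chart at `x₀`. -/
def transition (x₀ x : M) (y : E) : E :=
  extChartAt 𝓘(ℝ, E) x₀ ((extChartAt 𝓘(ℝ, E) x).symm y)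

omit [IsManifold 𝓘(ℝ, E) ∞ M] in
theorem transition_self (x₀ x : M) :
    transition x₀ x (extChartAt 𝓘(ℝ, E) x x) = extChartAt 𝓘(ℝ, E) x₀ x := by
  rw [transition, extChartAt_to_inv]

theorem tangentCoordChange_eq_fderiv (x₀ x x' : M) :
    tangentCoordChange 𝓘(ℝ, E) x x₀ x' = fderiv ℝ (transition x₀ x) (extChartAt 𝓘(ℝ, E) x x') := by
  rw [tangentCoordChange_def]
  simp only [modelWithCornersSelf_coe, Set.range_id, fderivWithin_univ]
  rfl

theorem contDiffAt_transition {x₀ x : M} (hx : x ∈ (extChartAt 𝓘(ℝ, E) x₀).source) :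
    ContDiffAt ℝ ∞ (transition x₀ x) (extChartAt 𝓘(ℝ, E) x x) := by
  have h := contDiffWithinAt_ext_coord_change (I := 𝓘(ℝ, E)) (n := ∞) x₀ x
    (y := extChartAt 𝓘(ℝ, E) x x) (by
      rw [PartialEquiv.trans_source'', PartialEquiv.symm_symm, PartialEquiv.symm_target]
      exact ⟨x, ⟨mem_extChartAt_source x, hx⟩, rfl⟩)
  simpa only [modelWithCornersSelf_coe, Set.range_id, contDiffWithinAt_univ] using! h

omit [IsManifold 𝓘(ℝ, E) ∞ M] in
theorem eventually_extChartAt_symm_mem_source {x₀ x : M}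
    (hx : x ∈ (extChartAt 𝓘(ℝ, E) x₀).source) :
    ∀ᶠ y in 𝓝 (extChartAt 𝓘(ℝ, E) x x), y ∈ (extChartAt 𝓘(ℝ, E) x).target ∧
      (extChartAt 𝓘(ℝ, E) x).symm y ∈ (extChartAt 𝓘(ℝ, E) x₀).source := by
  have h := (continuousAt_extChartAt_symm (I := 𝓘(ℝ, E)) x).preimage_mem_nhds
    (t := (extChartAt 𝓘(ℝ, E) x₀).source)
    (by rw [extChartAt_to_inv]; exact (isOpen_extChartAt_source x₀).mem_nhds hx)
  filter_upwards [h, extChartAt_target_mem_nhds (I := 𝓘(ℝ, E)) x] with y h1 h2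
  exact ⟨h2, h1⟩

/-- The derivative of the transition map at `x`, as a continuous linear equivalence. -/
def transitionEquiv {x₀ x : M} (hx : x ∈ (extChartAt 𝓘(ℝ, E) x₀).source) : E ≃L[ℝ] E :=
  ContinuousLinearEquiv.equivOfInverse (tangentCoordChange 𝓘(ℝ, E) x x₀ x)
    (tangentCoordChange 𝓘(ℝ, E) x₀ x x)
    (fun v => by
      rw [tangentCoordChange_comp ⟨⟨mem_extChartAt_source x, hx⟩, mem_extChartAt_source x⟩]
      exact tangentCoordChange_self (mem_extChartAt_source x))
    (fun v => by
      rw [tangentCoordChange_comp ⟨⟨hx, mem_extChartAt_source x⟩, hx⟩]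
      exact tangentCoordChange_self hx)

theorem transitionEquiv_symm_apply {x₀ x : M} (hx : x ∈ (extChartAt 𝓘(ℝ, E) x₀).source) (v : E) :
    (transitionEquiv hx).symm v = tangentCoordChange 𝓘(ℝ, E) x₀ x x v := rfl

theorem coe_transitionEquiv {x₀ x : M} (hx : x ∈ (extChartAt 𝓘(ℝ, E) x₀).source) :
    (transitionEquiv hx : E →L[ℝ] E) = fderiv ℝ (transition x₀ x) (extChartAt 𝓘(ℝ, E) x x) :=
  tangentCoordChange_eq_fderiv x₀ x x

theorem fderiv_transition_apply {x₀ x : M} (hx : x ∈ (extChartAt 𝓘(ℝ, E) x₀).source) (v : E) :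
    fderiv ℝ (transition x₀ x) (extChartAt 𝓘(ℝ, E) x x) v = transitionEquiv hx v := by
  rw [← coe_transitionEquiv hx]; rfl

/-! ### The charts of the tangent bundle -/

/-- The components of `q : TM` in the fibre direction, in the preferred chart at `q.proj`. -/
def fiberVec (q : TangentBundle 𝓘(ℝ, E) M) : E := q.2

theorem extChartAt_tangent_apply (p₀ p : TangentBundle 𝓘(ℝ, E) M) :
    extChartAt 𝓘(ℝ, E).tangent p₀ p =
      (extChartAt 𝓘(ℝ, E) p₀.proj p.proj,
        tangentCoordChange 𝓘(ℝ, E) p.proj p₀.proj p.proj p.2) := rfl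

theorem extChartAt_tangent_self (p : TangentBundle 𝓘(ℝ, E) M) :
    extChartAt 𝓘(ℝ, E).tangent p p = (extChartAt 𝓘(ℝ, E) p.proj p.proj, p.2) := by
  rw [extChartAt_tangent_apply]
  congr 1
  exact tangentCoordChange_self (mem_extChartAt_source _)

theorem mem_extChartAt_tangent_source (p₀ p : TangentBundle 𝓘(ℝ, E) M) :
    p ∈ (extChartAt 𝓘(ℝ, E).tangent p₀).source ↔
      p.proj ∈ (extChartAt 𝓘(ℝ, E) p₀.proj).source := by
  simp only [extChartAt_source]
  exact TangentBundle.mem_chart_source_iff p p₀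

theorem extChartAt_tangent_symm_apply (p₀ : TangentBundle 𝓘(ℝ, E) M) {z : E × E}
    (hz : z.1 ∈ (extChartAt 𝓘(ℝ, E) p₀.proj).target) :
    (extChartAt 𝓘(ℝ, E).tangent p₀).symm z =
      ⟨(extChartAt 𝓘(ℝ, E) p₀.proj).symm z.1,
        tangentCoordChange 𝓘(ℝ, E) p₀.proj ((extChartAt 𝓘(ℝ, E) p₀.proj).symm z.1)
          ((extChartAt 𝓘(ℝ, E) p₀.proj).symm z.1) z.2⟩ := by
  have hx := (extChartAt 𝓘(ℝ, E) p₀.proj).map_target hz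
  set x := (extChartAt 𝓘(ℝ, E) p₀.proj).symm z.1 with hxdef
  set q : TangentBundle 𝓘(ℝ, E) M := ⟨x, tangentCoordChange 𝓘(ℝ, E) p₀.proj x x z.2⟩ with hq
  have h1 : extChartAt 𝓘(ℝ, E).tangent p₀ q = z := by
    rw [extChartAt_tangent_apply]
    refine Prod.ext ((extChartAt 𝓘(ℝ, E) p₀.proj).right_inv hz) ?_
    change tangentCoordChange 𝓘(ℝ, E) x p₀.proj x (tangentCoordChange 𝓘(ℝ, E) p₀.proj x x z.2) = z.2
    rw [tangentCoordChange_comp ⟨⟨hx, mem_extChartAt_source x⟩, hx⟩]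
    exact tangentCoordChange_self hx
  rw [← h1]
  exact (extChartAt 𝓘(ℝ, E).tangent p₀).left_inv ((mem_extChartAt_tangent_source p₀ q).2 hx)

/-- The change of coordinates of the tangent bundle, `(y, w) ↦ (τ y, Dτ(y) w)`. -/
theorem eventually_tangent_transition {p₀ p : TangentBundle 𝓘(ℝ, E) M}
    (hp : p.proj ∈ (extChartAt 𝓘(ℝ, E) p₀.proj).source) :
    ∀ᶠ z in 𝓝 (extChartAt 𝓘(ℝ, E).tangent p p),
      (extChartAt 𝓘(ℝ, E).tangent p₀ ∘ (extChartAt 𝓘(ℝ, E).tangent p).symm) z =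
        (transition p₀.proj p.proj z.1, fderiv ℝ (transition p₀.proj p.proj) z.1 z.2) := by
  have h := eventually_extChartAt_symm_mem_source hp
  have h' : Tendsto Prod.fst (𝓝 (extChartAt 𝓘(ℝ, E).tangent p p))
      (𝓝 (extChartAt 𝓘(ℝ, E) p.proj p.proj)) := by
    rw [extChartAt_tangent_self]
    exact continuous_fst.continuousAt
  filter_upwards [h'.eventually h] with z hz
  rw [Function.comp_apply, extChartAt_tangent_symm_apply p hz.1, extChartAt_tangent_apply]
  refine Prod.ext rfl ?_
  have hx := (extChartAt 𝓘(ℝ, E) p.proj).map_target hz.1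
  set x := (extChartAt 𝓘(ℝ, E) p.proj).symm z.1 with hxdef
  change tangentCoordChange 𝓘(ℝ, E) x p₀.proj x (tangentCoordChange 𝓘(ℝ, E) p.proj x x z.2) = _
  rw [tangentCoordChange_comp ⟨⟨hx, mem_extChartAt_source x⟩, hz.2⟩, tangentCoordChange_eq_fderiv,
    hxdef, (extChartAt 𝓘(ℝ, E) p.proj).right_inv hz.1]

omit [IsManifold 𝓘(ℝ, E) ∞ M] in
-- Used twice: with `τ` a transition map it gives the coordinate change of vectors tangent to `TM`,
-- and with `τ` the components of `X` it gives the derivative of the complete lift.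
theorem hasFDerivAt_tangentMap {τ : E → E} {y : E} (hτ : ContDiffAt ℝ ∞ τ y) (v : E) :
    HasFDerivAt (fun z : E × E => (τ z.1, fderiv ℝ τ z.1 z.2))
      (((fderiv ℝ τ y).comp (ContinuousLinearMap.fst ℝ E E)).prod
        ((fderiv ℝ (fderiv ℝ τ) y).flip v ∘L ContinuousLinearMap.fst ℝ E E +
          fderiv ℝ τ y ∘L ContinuousLinearMap.snd ℝ E E)) (y, v) := by
  have h1 : HasFDerivAt τ (fderiv ℝ τ y) y := (hτ.differentiableAt (by simp)).hasFDerivAt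
  have h2 : HasFDerivAt (fderiv ℝ τ) (fderiv ℝ (fderiv ℝ τ) y) y :=
    ((hτ.fderiv_right (m := 1) (by decide)).differentiableAt (by simp)).hasFDerivAt
  have h3 : HasFDerivAt (Prod.fst : E × E → E) (ContinuousLinearMap.fst ℝ E E) (y, v) :=
    hasFDerivAt_fst
  have h4 : HasFDerivAt (Prod.snd : E × E → E) (ContinuousLinearMap.snd ℝ E E) (y, v) :=
    hasFDerivAt_snd
  have h5 := (HasFDerivAt.comp (y, v) (g := τ) h1 h3).prodMk
    ((HasFDerivAt.comp (y, v) (g := fderiv ℝ τ) h2 h3).clm_apply h4)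
  refine h5.congr_fderiv ?_
  ext <;> simp

/-- The components of vectors tangent to `TM` change by
`(a, b) ↦ (Dτ a, D²τ(a, v) + Dτ b)`. -/
theorem tangentCoordChange_tangent_apply {p₀ p : TangentBundle 𝓘(ℝ, E) M}
    (hp : p.proj ∈ (extChartAt 𝓘(ℝ, E) p₀.proj).source) (a b : E) :
    tangentCoordChange 𝓘(ℝ, E).tangent p p₀ p (a, b) =
      (transitionEquiv hp a,
        fderiv ℝ (fderiv ℝ (transition p₀.proj p.proj)) (extChartAt 𝓘(ℝ, E) p.proj p.proj) a (fiberVec p) +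
          transitionEquiv hp b) := by
  have h := (hasFDerivAt_tangentMap (contDiffAt_transition hp) (fiberVec p)).congr_of_eventuallyEq
    (extChartAt_tangent_self p ▸ eventually_tangent_transition hp)
  have h' : ∀ (f : E × E → E × E) (s : Set (E × E)) (z z' : E × E) (A : E × E →L[ℝ] E × E),
      s = Set.univ → z = z' → HasFDerivAt f A z' → fderivWithin ℝ f s z = A := by
    rintro f s z z' A rfl rfl hf
    rw [fderivWithin_univ, hf.fderiv]
  rw [tangentCoordChange_def, h' _ _ _ _ _ 𝓘(ℝ, E).tangent.range_eq_univ
    (extChartAt_tangent_self p) h]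
  simp only [← fderiv_transition_apply hp]
  rfl

theorem extChartAt_tangent_eq {p₀ q : TangentBundle 𝓘(ℝ, E) M}
    (hq : q.proj ∈ (extChartAt 𝓘(ℝ, E) p₀.proj).source) :
    extChartAt 𝓘(ℝ, E).tangent p₀ q =
      (extChartAt 𝓘(ℝ, E) p₀.proj q.proj, transitionEquiv hq (fiberVec q)) := rfl

end Transition

/-! ## Metrics, Christoffel symbols and Killing fields on an open set of a vector space -/

section Calculus

variable {E : Type*} [NormedAddCommGroup E] [NormedSpace ℝ E]

theorem bilinDeriv_apply {g : E → E →L[ℝ] E →L[ℝ] ℝ} {y : E} (hg : DifferentiableAt ℝ g y)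
    (c a b : E) : bilinDeriv g y c a b = fderiv ℝ (fun y => g y a b) y c := by
  have h := (hg.hasFDerivAt.clm_apply (hasFDerivAt_const a y)).clm_apply (hasFDerivAt_const b y)
  rw [h.fderiv]
  simp [bilinDeriv]

theorem bilinDeriv_symm {g : E → E →L[ℝ] E →L[ℝ] ℝ} {y : E} (hg : DifferentiableAt ℝ g y)
    (hsymm : ∀ᶠ y in 𝓝 y, ∀ a b, g y a b = g y b a) (c a b : E) :
    bilinDeriv g y c a b = bilinDeriv g y c b a := by
  rw [bilinDeriv_apply hg, bilinDeriv_apply hg]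
  congr 1
  exact EventuallyEq.fderiv_eq (hsymm.mono fun y h => h a b)

/-- The first derivatives of the metric coefficients in two charts related by `τ`. -/
theorem bilinDeriv_pullback {τ : E → E} {y : E} {g₀ g₁ : E → E →L[ℝ] E →L[ℝ] ℝ}
    (hτ : ContDiffAt ℝ ∞ τ y) (hg₀ : DifferentiableAt ℝ g₀ (τ y)) (hg₁ : DifferentiableAt ℝ g₁ y)
    (h : ∀ᶠ y in 𝓝 y, ∀ a b, g₁ y a b = g₀ (τ y) (fderiv ℝ τ y a) (fderiv ℝ τ y b)) (c a b : E) :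
    bilinDeriv g₁ y c a b =
      bilinDeriv g₀ (τ y) (fderiv ℝ τ y c) (fderiv ℝ τ y a) (fderiv ℝ τ y b) +
      g₀ (τ y) (fderiv ℝ (fderiv ℝ τ) y c a) (fderiv ℝ τ y b) +
      g₀ (τ y) (fderiv ℝ τ y a) (fderiv ℝ (fderiv ℝ τ) y c b) := by
  have h1 : HasFDerivAt τ (fderiv ℝ τ y) y := (hτ.differentiableAt (by simp)).hasFDerivAt
  have h2 : HasFDerivAt (fderiv ℝ τ) (fderiv ℝ (fderiv ℝ τ) y) y :=
    ((hτ.fderiv_right (m := 1) (by decide)).differentiableAt (by simp)).hasFDerivAt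
  have h3 : HasFDerivAt (fun y => g₀ (τ y)) (bilinDeriv g₀ (τ y) ∘L fderiv ℝ τ y) y :=
    HasFDerivAt.comp (g := g₀) y hg₀.hasFDerivAt h1
  have h4 := (h3.clm_apply (h2.clm_apply (hasFDerivAt_const a y))).clm_apply
    (h2.clm_apply (hasFDerivAt_const b y))
  rw [bilinDeriv_apply hg₁, (h4.congr_of_eventuallyEq (h.mono fun y h => h a b)).fderiv]
  simp
  ring

/-- Each metric derivative contributes two terms in `D²τ`. By symmetry of `D²τ` and of the metric,
four of the six cancel in the Koszul combination and the other two are equal, which absorbs the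
factor `1 / 2`. -/
theorem christoffelFirst_pullback {τ : E → E} {y : E} {g₀ g₁ : E → E →L[ℝ] E →L[ℝ] ℝ}
    (hτ : ContDiffAt ℝ ∞ τ y) (hg₀ : DifferentiableAt ℝ g₀ (τ y)) (hg₁ : DifferentiableAt ℝ g₁ y)
    (h : ∀ᶠ y in 𝓝 y, ∀ a b, g₁ y a b = g₀ (τ y) (fderiv ℝ τ y a) (fderiv ℝ τ y b))
    (hsymm : ∀ a b, g₀ (τ y) a b = g₀ (τ y) b a) (a b c : E) :
    christoffelFirst (bilinDeriv g₁ y) a b c =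
      christoffelFirst (bilinDeriv g₀ (τ y)) (fderiv ℝ τ y a) (fderiv ℝ τ y b) (fderiv ℝ τ y c) +
      g₀ (τ y) (fderiv ℝ (fderiv ℝ τ) y a b) (fderiv ℝ τ y c) := by
  have hs : ∀ u v, fderiv ℝ (fderiv ℝ τ) y u v = fderiv ℝ (fderiv ℝ τ) y v u :=
    fun u v => (hτ.isSymmSndFDerivAt (by simpa using! (by decide : (2 : WithTop ℕ∞) ≤ ∞))).eq u v
  simp only [christoffelFirst, bilinDeriv_pullback hτ hg₀ hg₁ h]
  rw [hs b a, hs c a, hs c b, hsymm (fderiv ℝ τ y b) (fderiv ℝ (fderiv ℝ τ) y a c),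
    hsymm (fderiv ℝ τ y a) (fderiv ℝ (fderiv ℝ τ) y b c)]
  ring

/-- The derivatives of the components of a vector field in two charts related by `τ`. -/
theorem fderiv_pushforward {τ : E → E} {y : E} {X₀ X₁ : E → E}
    (hτ : ContDiffAt ℝ ∞ τ y) (hX₀ : DifferentiableAt ℝ X₀ (τ y)) (hX₁ : DifferentiableAt ℝ X₁ y)
    (h : ∀ᶠ y in 𝓝 y, X₀ (τ y) = fderiv ℝ τ y (X₁ y)) (w : E) :
    fderiv ℝ X₀ (τ y) (fderiv ℝ τ y w) =
      fderiv ℝ (fderiv ℝ τ) y w (X₁ y) + fderiv ℝ τ y (fderiv ℝ X₁ y w) := by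
  have h1 : HasFDerivAt τ (fderiv ℝ τ y) y := (hτ.differentiableAt (by simp)).hasFDerivAt
  have h2 : HasFDerivAt (fderiv ℝ τ) (fderiv ℝ (fderiv ℝ τ) y) y :=
    ((hτ.fderiv_right (m := 1) (by decide)).differentiableAt (by simp)).hasFDerivAt
  have h3 := HasFDerivAt.comp y hX₀.hasFDerivAt h1
  have h4 := (h2.clm_apply hX₁.hasFDerivAt).congr_of_eventuallyEq h
  have h5 := DFunLike.congr_fun (h3.unique h4) w
  simp at h5
  rw [h5, add_comm]

/-- The Lie derivative of the metric `g` along `X`, in coordinates. -/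
def killingForm (g : E → E →L[ℝ] E →L[ℝ] ℝ) (X : E → E) (y a b : E) : ℝ :=
  bilinDeriv g y (X y) a b + g y (fderiv ℝ X y a) b + g y a (fderiv ℝ X y b)

/-- The terms in `D²τ` from differentiating the metric coefficients are `D²τ(X, a)` and `D²τ(X, b)`;
those from differentiating the components of `X` are `D²τ(a, X)` and `D²τ(b, X)`. They agree by
symmetry, so the Lie derivative of the metric is a tensor. -/
theorem killingForm_pullback {τ : E → E} {y : E} {g₀ g₁ : E → E →L[ℝ] E →L[ℝ] ℝ} {X₀ X₁ : E → E}
    (hτ : ContDiffAt ℝ ∞ τ y) (hg₀ : DifferentiableAt ℝ g₀ (τ y)) (hg₁ : DifferentiableAt ℝ g₁ y)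
    (h : ∀ᶠ y in 𝓝 y, ∀ a b, g₁ y a b = g₀ (τ y) (fderiv ℝ τ y a) (fderiv ℝ τ y b))
    (hX₀ : DifferentiableAt ℝ X₀ (τ y)) (hX₁ : DifferentiableAt ℝ X₁ y)
    (hX : ∀ᶠ y in 𝓝 y, X₀ (τ y) = fderiv ℝ τ y (X₁ y)) (a b : E) :
    killingForm g₁ X₁ y a b = killingForm g₀ X₀ (τ y) (fderiv ℝ τ y a) (fderiv ℝ τ y b) := by
  have hs : ∀ u v, fderiv ℝ (fderiv ℝ τ) y u v = fderiv ℝ (fderiv ℝ τ) y v u :=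
    fun u v => (hτ.isSymmSndFDerivAt (by simpa using! (by decide : (2 : WithTop ℕ∞) ≤ ∞))).eq u v
  simp only [killingForm, bilinDeriv_pullback hτ hg₀ hg₁ h, fderiv_pushforward hτ hX₀ hX₁ hX,
    h.self_of_nhds, hX.self_of_nhds, map_add, add_apply]
  rw [hs a, hs b]
  ring

/-- `christoffelFirst` as a continuous bilinear map valued in covectors. -/
def christoffelFirstL (G : E →L[ℝ] E →L[ℝ] E →L[ℝ] ℝ) : E →L[ℝ] E →L[ℝ] E →L[ℝ] ℝ :=
  (1 / 2 : ℝ) • (G + G.flip -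
    ((ContinuousLinearMap.flipₗᵢ ℝ E E ℝ).toContinuousLinearEquiv : _ →L[ℝ] _) ∘L G.flip)

/-- The Christoffel symbols of the second kind of the metric `g`. -/
def christoffelSecond (g : E → E →L[ℝ] E →L[ℝ] ℝ) (y : E) : E →L[ℝ] E →L[ℝ] E :=
  ContinuousLinearMap.compL ℝ E (E →L[ℝ] ℝ) E (g y).inverse ∘L christoffelFirstL (bilinDeriv g y)

theorem metric_christoffelSecond {g : E → E →L[ℝ] E →L[ℝ] ℝ} {y : E} (hg : (g y).IsInvertible)
    (a b c : E) : g y (christoffelSecond g y a b) c = christoffelFirst (bilinDeriv g y) a b c := by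
  obtain ⟨e, he⟩ := hg
  simp [christoffelSecond, ← he]
  rfl

set_option synthInstance.maxHeartbeats 100000 in
-- Inversion of continuous linear maps is smooth at an invertible one (here completeness of `E`
-- enters), and the remaining operations are linear in the first derivative of `g`.
theorem contDiffAt_christoffelSecond [CompleteSpace E] {g : E → E →L[ℝ] E →L[ℝ] ℝ} {y : E}
    (hg : ContDiffAt ℝ ∞ g y) (hinv : (g y).IsInvertible) :
    ContDiffAt ℝ ∞ (christoffelSecond g) y := by
  obtain ⟨e, he⟩ := hinv
  have h1 : ContDiffAt ℝ ∞ (fun y => (g y).inverse) y := by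
    have := contDiffAt_map_inverse (𝕜 := ℝ) (n := ∞) e
    rw [he] at this
    exact this.comp y hg
  have h2 : ContDiffAt ℝ ∞ (bilinDeriv g) y := hg.fderiv_right (by decide)
  have h3 : ContDiffAt ℝ ∞ (fun y => (bilinDeriv g y).flip) y :=
    (ContinuousLinearMap.flipₗᵢ ℝ E E (E →L[ℝ] ℝ)).contDiff.contDiffAt.comp y h2
  have h4 : ContDiffAt ℝ ∞ (fun y => christoffelFirstL (bilinDeriv g y)) y :=
    ((h2.add h3).sub (contDiffAt_const.clm_comp h3)).const_smul _
  exact ((ContinuousLinearMap.compL ℝ E (E →L[ℝ] ℝ) E).contDiff.contDiffAt.comp y h1).clm_comp h4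

/-- The derivative of the Killing equation. -/
theorem fderiv_killing_eq_zero [CompleteSpace E] {g : E → E →L[ℝ] E →L[ℝ] ℝ} {X : E → E} {y : E}
    (hg : ContDiffAt ℝ ∞ g y) (hX : ContDiffAt ℝ ∞ X y)
    (hK : ∀ᶠ y in 𝓝 y, ∀ a b, killingForm g X y a b = 0) (a b c : E) :
    fderiv ℝ (bilinDeriv g) y (X y) c a b + bilinDeriv g y (fderiv ℝ X y c) a b +
      bilinDeriv g y c (fderiv ℝ X y a) b + bilinDeriv g y c a (fderiv ℝ X y b) +
      g y (fderiv ℝ (fderiv ℝ X) y c a) b + g y a (fderiv ℝ (fderiv ℝ X) y c b) = 0 := by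
  have hG : HasFDerivAt (bilinDeriv g) (fderiv ℝ (bilinDeriv g) y) y :=
    ((hg.fderiv_right (m := 1) (by decide)).differentiableAt (by simp)).hasFDerivAt
  have hg' : HasFDerivAt g (bilinDeriv g y) y := (hg.differentiableAt (by simp)).hasFDerivAt
  have hX1 : HasFDerivAt X (fderiv ℝ X y) y := (hX.differentiableAt (by simp)).hasFDerivAt
  have hX2 : HasFDerivAt (fderiv ℝ X) (fderiv ℝ (fderiv ℝ X) y) y :=
    ((hX.fderiv_right (m := 1) (by decide)).differentiableAt (by simp)).hasFDerivAt
  have ha := hasFDerivAt_const (𝕜 := ℝ) a y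
  have hb := hasFDerivAt_const (𝕜 := ℝ) b y
  have h1 := ((((hG.clm_apply hX1).clm_apply ha).clm_apply hb).add
    ((hg'.clm_apply (hX2.clm_apply ha)).clm_apply hb)).add
    ((hg'.clm_apply ha).clm_apply (hX2.clm_apply hb))
  have h2 := (hasFDerivAt_const (𝕜 := ℝ) (0 : ℝ) y).congr_of_eventuallyEq (hK.mono fun y h => h a b)
  have h3 := DFunLike.congr_fun (h1.unique h2) c
  -- Second derivatives of `g` commute. The term is thereby rewritten as a derivative along `X`, the
  -- form in which it appears when the Christoffel symbols are differentiated along `X`.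
  have hs : fderiv ℝ (bilinDeriv g) y (X y) c = fderiv ℝ (bilinDeriv g) y c (X y) :=
    (hg.isSymmSndFDerivAt (by simpa using! (by decide : (2 : WithTop ℕ∞) ≤ ∞))).eq _ _
  simp at h3
  rw [hs]
  linarith

/-- A Killing field preserves the Levi-Civita connection. -/
theorem fderiv_christoffelSecond_of_killing [CompleteSpace E] {g : E → E →L[ℝ] E →L[ℝ] ℝ}
    {X : E → E} {y : E}
    (hg : ContDiffAt ℝ ∞ g y) (hinv : (g y).IsInvertible) (hX : ContDiffAt ℝ ∞ X y)
    (hsymm : ∀ᶠ y in 𝓝 y, ∀ a b, g y a b = g y b a)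
    (hK : ∀ᶠ y in 𝓝 y, ∀ a b, killingForm g X y a b = 0) (a b : E) :
    fderiv ℝ (christoffelSecond g) y (X y) a b =
      fderiv ℝ X y (christoffelSecond g y a b) - christoffelSecond g y (fderiv ℝ X y a) b -
        christoffelSecond g y a (fderiv ℝ X y b) - fderiv ℝ (fderiv ℝ X) y a b := by
  have hG : HasFDerivAt (bilinDeriv g) (fderiv ℝ (bilinDeriv g) y) y :=
    ((hg.fderiv_right (m := 1) (by decide)).differentiableAt (by simp)).hasFDerivAt
  have hg' : HasFDerivAt g (bilinDeriv g y) y := (hg.differentiableAt (by simp)).hasFDerivAt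
  have hΓ : HasFDerivAt (christoffelSecond g) (fderiv ℝ (christoffelSecond g) y) y :=
    ((contDiffAt_christoffelSecond hg hinv).differentiableAt (by simp)).hasFDerivAt
  have ha := hasFDerivAt_const (𝕜 := ℝ) a y
  have hb := hasFDerivAt_const (𝕜 := ℝ) b y
  have hev : ∀ᶠ y in 𝓝 y, (g y).IsInvertible :=
    hg.continuousAt.eventually (ContinuousLinearEquiv.isOpen.mem_nhds hinv)
  have hD2 : ∀ u v, fderiv ℝ (fderiv ℝ X) y u v = fderiv ℝ (fderiv ℝ X) y v u :=
    fun u v => (hX.isSymmSndFDerivAt (by simpa using! (by decide : (2 : WithTop ℕ∞) ≤ ∞))).eq u v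
  have hGs : ∀ c a b, bilinDeriv g y c a b = bilinDeriv g y c b a :=
    bilinDeriv_symm (hg.differentiableAt (by simp)) hsymm
  have hgs := hsymm.self_of_nhds
  have hinj : Function.Injective (g y) := by
    obtain ⟨e, he⟩ := hinv
    rw [← he]
    exact e.injective
  -- The metric is nondegenerate, so both sides may be lowered with `g` and tested on a vector `c`.
  apply hinj
  ext c
  have hc := hasFDerivAt_const (𝕜 := ℝ) c y
  -- `h1` and `h2` differentiate the two sides of the Koszul formula `g(Γ(a, b), c) =
  -- christoffelFirst a b c`, which holds near `y` because invertibility of the metric is an open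
  -- condition.
  have h1 := (hg'.clm_apply ((hΓ.clm_apply ha).clm_apply hb)).clm_apply hc
  have h2 := (((((hG.clm_apply ha).clm_apply hb).clm_apply hc).add
    (((hG.clm_apply hb).clm_apply ha).clm_apply hc)).sub
    (((hG.clm_apply hc).clm_apply ha).clm_apply hb)).const_mul (1 / 2)
  have h3 := DFunLike.congr_fun (h1.unique (h2.congr_of_eventuallyEq
    (hev.mono fun y h => metric_christoffelSecond h a b c))) (X y)
  -- The combination `hk1 + hk2 - hk3` evaluates the derivative of the first-kind symbols along `X`.
  -- The undifferentiated equation `hk4`, at `(Γ(a, b), c)`, removes the term where `X`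
  -- differentiates `g` in `g(Γ(a, b), c)` and produces `DX Γ(a, b)`.
  have hk1 := fderiv_killing_eq_zero hg hX hK b c a
  have hk2 := fderiv_killing_eq_zero hg hX hK a c b
  have hk3 := fderiv_killing_eq_zero hg hX hK a b c
  have hk4 := hK.self_of_nhds (christoffelSecond g y a b) c
  have m := metric_christoffelSecond hinv
  simp only [killingForm, m] at hk4
  simp at h3
  simp only [map_sub, sub_apply, m]
  simp only [christoffelFirst] at hk4 ⊢
  have f1 : g y b (fderiv ℝ (fderiv ℝ X) y a c) = g y (fderiv ℝ (fderiv ℝ X) y c a) b := by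
    rw [hgs b, hD2 a c]
  have f2 : g y a (fderiv ℝ (fderiv ℝ X) y b c) = g y a (fderiv ℝ (fderiv ℝ X) y c b) := by
    rw [hD2 b c]
  have f3 : g y (fderiv ℝ (fderiv ℝ X) y b a) c = g y (fderiv ℝ (fderiv ℝ X) y a b) c := by
    rw [hD2 b a]
  have e2 := hGs c a (fderiv ℝ X y b)
  have e3 := hGs c (fderiv ℝ X y a) b
  linarith

/-- The transpose of the mirror endomorphism in coordinates, for the Christoffel symbols `Γ`. -/
def coordMirrorAdjoint (Γ : E → E →L[ℝ] E →L[ℝ] E) (z : E × E) (ζ : E × E) : E × E :=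
  (ζ.2 + Γ z.1 ζ.1 z.2, -Γ z.1 (ζ.2 + Γ z.1 ζ.1 z.2) z.2)

/-- The complete lift in coordinates. -/
def coordCompleteLift (X : E → E) (z : E × E) : E × E := (X z.1, fderiv ℝ X z.1 z.2)

theorem contDiffAt_coordCompleteLift {X : E → E} {z : E × E} (hX : ContDiffAt ℝ ∞ X z.1) :
    ContDiffAt ℝ ∞ (coordCompleteLift X) z := by
  have h : ContDiffAt ℝ ∞ (fderiv ℝ X) z.1 := hX.fderiv_right (by decide)
  exact (hX.comp z contDiffAt_fst).prodMk ((h.comp z contDiffAt_fst).clm_apply contDiffAt_snd)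

theorem fderiv_coordCompleteLift {X : E → E} {z : E × E} (hX : ContDiffAt ℝ ∞ X z.1) (ζ : E × E) :
    fderiv ℝ (coordCompleteLift X) z ζ =
      (fderiv ℝ X z.1 ζ.1, fderiv ℝ (fderiv ℝ X) z.1 ζ.1 z.2 + fderiv ℝ X z.1 ζ.2) := by
  have h := hasFDerivAt_tangentMap hX z.2
  have h' : fderiv ℝ (coordCompleteLift X) z = _ := h.fderiv
  rw [h']
  simp

theorem contDiffAt_coordMirrorAdjoint {Γ : E → E →L[ℝ] E →L[ℝ] E} {z : E × E} {Z : E × E → E × E}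
    (hΓ : ContDiffAt ℝ ∞ Γ z.1) (hZ : ContDiffAt ℝ ∞ Z z) :
    ContDiffAt ℝ ∞ (fun z => coordMirrorAdjoint Γ z (Z z)) z := by
  have h1 : ContDiffAt ℝ ∞ (fun z : E × E => Γ z.1) z := hΓ.comp z contDiffAt_fst
  have h2 := hZ.snd.add ((h1.clm_apply hZ.fst).clm_apply contDiffAt_snd)
  exact h2.prodMk ((h1.clm_apply h2).clm_apply contDiffAt_snd).neg

/-- The hypothesis `h` says that the Lie derivative of the connection along `X` vanishes. Its term
`D²X(a, v)` is the one that the fibre component `DX v` of the lift contributes to the bracket with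
`Z`; once it is matched, `Γ` is carried through the bracket. -/
theorem lieBracket_coordMirrorAdjoint {Γ : E → E →L[ℝ] E →L[ℝ] E} {X : E → E} {z : E × E}
    {Z : E × E → E × E} (hΓ : DifferentiableAt ℝ Γ z.1) (hX : ContDiffAt ℝ ∞ X z.1)
    (hZ : DifferentiableAt ℝ Z z)
    (h : ∀ a b, fderiv ℝ Γ z.1 (X z.1) a b = fderiv ℝ X z.1 (Γ z.1 a b) -
      Γ z.1 (fderiv ℝ X z.1 a) b - Γ z.1 a (fderiv ℝ X z.1 b) - fderiv ℝ (fderiv ℝ X) z.1 a b) :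
    VectorField.lieBracket ℝ (coordCompleteLift X) (fun z => coordMirrorAdjoint Γ z (Z z)) z =
      coordMirrorAdjoint Γ z (VectorField.lieBracket ℝ (coordCompleteLift X) Z z) := by
  have h1 : HasFDerivAt (fun z : E × E => Γ z.1) (fderiv ℝ Γ z.1 ∘L ContinuousLinearMap.fst ℝ E E) z :=
    HasFDerivAt.comp (g := Γ) z hΓ.hasFDerivAt hasFDerivAt_fst
  have hs : HasFDerivAt (Prod.snd : E × E → E) (ContinuousLinearMap.snd ℝ E E) z :=
    hasFDerivAt_snd
  have h2 := hZ.hasFDerivAt.snd.add ((h1.clm_apply hZ.hasFDerivAt.fst).clm_apply hs)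
  have h3 := h2.prodMk ((h1.clm_apply h2).clm_apply hs).neg
  have h4 : fderiv ℝ (fun z => coordMirrorAdjoint Γ z (Z z)) z = _ := h3.fderiv
  simp only [VectorField.lieBracket, h4, fderiv_coordCompleteLift hX]
  refine Prod.ext ?_ ?_
  · simp [coordMirrorAdjoint, coordCompleteLift, h]
    abel
  · simp [coordMirrorAdjoint, coordCompleteLift, h]
    abel

end Calculus

/-- A finite basis identifies `E →L[ℝ] F` with a finite power of `F`. Applied twice, this reduces
smoothness of the metric coefficients to inner products of constant fields. -/
theorem contDiffAt_clm_apply_iff {D E F : Type*} [NormedAddCommGroup D] [NormedSpace ℝ D]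
    [NormedAddCommGroup E] [NormedSpace ℝ E] [NormedAddCommGroup F] [NormedSpace ℝ F]
    [FiniteDimensional ℝ E] {f : D → E →L[ℝ] F} {x : D} :
    ContDiffAt ℝ ∞ f x ↔ ∀ y, ContDiffAt ℝ ∞ (fun x => f x y) x := by
  refine ⟨fun h y => h.clm_apply contDiffAt_const, fun h => ?_⟩
  let d := Module.finrank ℝ E
  have hd : d = Module.finrank ℝ (Fin d → ℝ) := (Module.finrank_fin_fun ℝ).symm
  let e₁ := ContinuousLinearEquiv.ofFinrankEq hd
  let e₂ := (e₁.arrowCongr (1 : F ≃L[ℝ] F)).trans (ContinuousLinearEquiv.piRing (Fin d))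
  rw [← Function.id_comp f, ← e₂.symm_comp_self]
  exact e₂.symm.contDiff.contDiffAt.comp x (contDiffAt_pi.mpr fun i => h _)

/-! ## Vector fields in charts -/

section FieldInChart

variable {E : Type*} [NormedAddCommGroup E] [NormedSpace ℝ E]
  {M : Type*} [TopologicalSpace M] [ChartedSpace E M] [IsManifold 𝓘(ℝ, E) ∞ M]

/-- The vector field with constant components `a` in the preferred chart at `x₀`. -/
def constField (x₀ : M) (a : E) (x : M) : TangentSpace 𝓘(ℝ, E) x :=
  tangentCoordChange 𝓘(ℝ, E) x₀ x x a

theorem coordField_constField (x₀ : M) (a : E) :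
    coordField 𝓘(ℝ, E) x₀ (constField x₀ a) =ᶠ[𝓝 (extChartAt 𝓘(ℝ, E) x₀ x₀)] fun _ => a := by
  filter_upwards [extChartAt_target_mem_nhds (I := 𝓘(ℝ, E)) x₀] with y hy
  have h := (extChartAt 𝓘(ℝ, E) x₀).map_target hy
  exact (transitionEquiv h).apply_symm_apply a

theorem smoothFieldAt_constField (x₀ : M) (a : E) :
    SmoothFieldAt 𝓘(ℝ, E) (constField x₀ a) x₀ :=
  (smoothFieldAt_iff _ _ _).2 (contDiffAt_const.congr_of_eventuallyEq (coordField_constField x₀ a))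

theorem constField_self (x : M) (a : E) : constField x a x = a := by
  have h : tangentCoordChange 𝓘(ℝ, E) x x x a = a :=
    tangentCoordChange_self (mem_extChartAt_source x)
  exact h

/-- The components of a vector field in two charts. -/
theorem eventually_coordField_eq (X : ∀ x : M, TangentSpace 𝓘(ℝ, E) x) {x₀ x : M}
    (hx : x ∈ (extChartAt 𝓘(ℝ, E) x₀).source) :
    ∀ᶠ y in 𝓝 (extChartAt 𝓘(ℝ, E) x x), coordField 𝓘(ℝ, E) x₀ X (transition x₀ x y) =
      fderiv ℝ (transition x₀ x) y (coordField 𝓘(ℝ, E) x X y) := by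
  filter_upwards [eventually_extChartAt_symm_mem_source hx] with y hy
  have h1 := (extChartAt 𝓘(ℝ, E) x).map_target hy.1
  have h2 : (extChartAt 𝓘(ℝ, E) x₀).symm (transition x₀ x y) = (extChartAt 𝓘(ℝ, E) x).symm y :=
    (extChartAt 𝓘(ℝ, E) x₀).left_inv hy.2
  rw [coordField, h2, coordField]
  set x' := (extChartAt 𝓘(ℝ, E) x).symm y with hx'
  have h3 : y = extChartAt 𝓘(ℝ, E) x x' := ((extChartAt 𝓘(ℝ, E) x).right_inv hy.1).symm
  rw [h3, ← tangentCoordChange_eq_fderiv]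
  exact (tangentCoordChange_comp ⟨⟨mem_extChartAt_source x', h1⟩, hy.2⟩).symm

theorem eventually_differentiableAt_coordField {X : ∀ x : M, TangentSpace 𝓘(ℝ, E) x} {x₀ : M}
    (hX : SmoothFieldAt 𝓘(ℝ, E) X x₀) :
    ∀ᶠ x in 𝓝 x₀, DifferentiableAt ℝ (coordField 𝓘(ℝ, E) x₀ X) (extChartAt 𝓘(ℝ, E) x₀ x) := by
  -- Smoothness of order `∞` at a point need not hold on one common neighbourhood, whereas order `1`
  -- does spread to a neighbourhood.
  have h := ((((smoothFieldAt_iff _ _ _).1 hX).of_le (m := 1) (by decide)).eventually (by simp))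
  filter_upwards [(continuousAt_extChartAt (I := 𝓘(ℝ, E)) x₀).eventually h] with x hx
  exact hx.differentiableAt (by simp)

end FieldInChart

/-! ## The metric in charts -/

section MetricInChart

variable {E : Type*} [NormedAddCommGroup E] [NormedSpace ℝ E]
  {M : Type*} [TopologicalSpace M] [ChartedSpace E M] [IsManifold 𝓘(ℝ, E) ∞ M]
  [RiemannianBundle (fun x : M => TangentSpace 𝓘(ℝ, E) x)]

/-- The inner product of `TangentSpace 𝓘(ℝ, E) x`, with arguments of type `E`. -/
def tangentInner (x : M) (a b : E) : ℝ :=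
  (innerSL ℝ : TangentSpace 𝓘(ℝ, E) x →L[ℝ] TangentSpace 𝓘(ℝ, E) x →L[ℝ] ℝ) a b

theorem metricInChart_eq_tangentInner (x₀ : M) (y a b : E) :
    metricInChart x₀ y a b = tangentInner (E := E) ((extChartAt 𝓘(ℝ, E) x₀).symm y)
      ((trivializationAt E (TangentSpace 𝓘(ℝ, E)) x₀).symmL ℝ ((extChartAt 𝓘(ℝ, E) x₀).symm y) a)
      ((trivializationAt E (TangentSpace 𝓘(ℝ, E)) x₀).symmL ℝ
        ((extChartAt 𝓘(ℝ, E) x₀).symm y) b) := by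
  with_unfolding_all rfl

theorem metricInChart_apply {x₀ x : M} (hx : x ∈ (extChartAt 𝓘(ℝ, E) x₀).source) (a b : E) :
    metricInChart x₀ (extChartAt 𝓘(ℝ, E) x₀ x) a b =
      tangentInner x (tangentCoordChange 𝓘(ℝ, E) x₀ x x a)
        (tangentCoordChange 𝓘(ℝ, E) x₀ x x b) := by
  -- The base point occurs in the types of the fibres, so it is made a variable and substituted
  -- instead of being rewritten.
  have h : ∀ x' : M, x' = x → tangentInner (E := E) x'
      ((trivializationAt E (TangentSpace 𝓘(ℝ, E)) x₀).symmL ℝ x' a)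
      ((trivializationAt E (TangentSpace 𝓘(ℝ, E)) x₀).symmL ℝ x' b) =
      tangentInner x (tangentCoordChange 𝓘(ℝ, E) x₀ x x a)
        (tangentCoordChange 𝓘(ℝ, E) x₀ x x b) := by
    rintro _ rfl
    rw [extChartAt_source] at hx
    rw [TangentBundle.symmL_trivializationAt_eq_core hx]
    rfl
  rw [metricInChart_eq_tangentInner]
  exact h _ ((extChartAt 𝓘(ℝ, E) x₀).left_inv hx)

theorem metricInChart_transition {x₀ x : M} (hx : x ∈ (extChartAt 𝓘(ℝ, E) x₀).source) (a b : E) :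
    metricInChart x₀ (extChartAt 𝓘(ℝ, E) x₀ x) (transitionEquiv hx a) (transitionEquiv hx b) =
      tangentInner x a b := by
  rw [metricInChart_apply hx, ← transitionEquiv_symm_apply hx, ← transitionEquiv_symm_apply hx]
  simp

theorem metricInChart_self (x : M) (a b : E) :
    metricInChart x (extChartAt 𝓘(ℝ, E) x x) a b = tangentInner x a b := by
  rw [metricInChart_apply (mem_extChartAt_source x),
    tangentCoordChange_self (mem_extChartAt_source x),
    tangentCoordChange_self (mem_extChartAt_source x)]

omit [IsManifold 𝓘(ℝ, E) ∞ M] in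
theorem tangentInner_comm (x : M) (a b : E) : tangentInner x a b = tangentInner x b a :=
  (real_inner_comm (F := TangentSpace 𝓘(ℝ, E) x) _ _)

omit [IsManifold 𝓘(ℝ, E) ∞ M] in
theorem tangentInner_neg_left (x : M) (a b : E) : tangentInner x (-a) b = -tangentInner x a b :=
  inner_neg_left (E := TangentSpace 𝓘(ℝ, E) x) _ _

omit [IsManifold 𝓘(ℝ, E) ∞ M] in
theorem tangentInner_neg_right (x : M) (a b : E) : tangentInner x a (-b) = -tangentInner x a b :=
  inner_neg_right (E := TangentSpace 𝓘(ℝ, E) x) _ _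

omit [IsManifold 𝓘(ℝ, E) ∞ M] in
theorem tangentInner_pos (x : M) {a : E} (ha : a ≠ 0) : 0 < tangentInner x a a :=
  (real_inner_self_pos (F := TangentSpace 𝓘(ℝ, E) x)).2 ha

theorem metricInChart_symm (x₀ : M) (y a b : E) :
    metricInChart x₀ y a b = metricInChart x₀ y b a := by
  rw [metricInChart_eq_tangentInner, metricInChart_eq_tangentInner]
  exact tangentInner_comm _ _ _

theorem metricInChart_pos {x₀ : M} {y : E} (hy : y ∈ (extChartAt 𝓘(ℝ, E) x₀).target) {a : E}
    (ha : a ≠ 0) : 0 < metricInChart x₀ y a a := by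
  have hx := (extChartAt 𝓘(ℝ, E) x₀).map_target hy
  rw [← (extChartAt 𝓘(ℝ, E) x₀).right_inv hy, metricInChart_apply hx]
  refine tangentInner_pos _ fun h => ha ?_
  exact (transitionEquiv hx).symm.injective (h.trans (map_zero _).symm)

/-- The metric coefficients in two charts. -/
theorem eventually_metricInChart_eq {x₀ x : M} (hx : x ∈ (extChartAt 𝓘(ℝ, E) x₀).source) :
    ∀ᶠ y in 𝓝 (extChartAt 𝓘(ℝ, E) x x), ∀ a b, metricInChart x y a b =
      metricInChart x₀ (transition x₀ x y) (fderiv ℝ (transition x₀ x) y a)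
        (fderiv ℝ (transition x₀ x) y b) := by
  filter_upwards [eventually_extChartAt_symm_mem_source hx] with y hy a b
  have h1 := (extChartAt 𝓘(ℝ, E) x).map_target hy.1
  set x' := (extChartAt 𝓘(ℝ, E) x).symm y with hx'
  have h2 : y = extChartAt 𝓘(ℝ, E) x x' := ((extChartAt 𝓘(ℝ, E) x).right_inv hy.1).symm
  have h3 : transition x₀ x y = extChartAt 𝓘(ℝ, E) x₀ x' := rfl
  have h4 : ∀ w, tangentCoordChange 𝓘(ℝ, E) x₀ x' x' (fderiv ℝ (transition x₀ x) y w) =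
      tangentCoordChange 𝓘(ℝ, E) x x' x' w := fun w => by
    rw [h2, ← tangentCoordChange_eq_fderiv,
      tangentCoordChange_comp ⟨⟨h1, hy.2⟩, mem_extChartAt_source x'⟩]
  rw [h3, metricInChart_apply hy.2, h4, h4]
  conv_lhs => rw [h2]
  rw [metricInChart_apply h1]

variable [FiniteDimensional ℝ E]

/-- A positive definite form is injective as a map to the dual, and the dual has the same dimension.
-/
theorem metricInChart_isInvertible {x₀ : M} {y : E}
    (hy : y ∈ (extChartAt 𝓘(ℝ, E) x₀).target) : (metricInChart x₀ y).IsInvertible := by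
  have hinj : Function.Injective (metricInChart x₀ y) := by
    refine (injective_iff_map_eq_zero _).2 fun a ha => ?_
    by_contra h0
    have h := metricInChart_pos hy h0
    rw [ha] at h
    simp at h
  have hdim : Module.finrank ℝ E = Module.finrank ℝ (E →L[ℝ] ℝ) := by
    rw [← (LinearMap.toContinuousLinearMap (𝕜 := ℝ) (E := E) (F' := ℝ)).finrank_eq]
    exact (Subspace.dual_finrank_eq).symm
  let e := (LinearEquiv.ofInjectiveOfFinrankEq (metricInChart x₀ y : E →ₗ[ℝ] E →L[ℝ] ℝ) hinj
    hdim).toContinuousLinearEquiv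
  exact ⟨e, rfl⟩

variable [IsContMDiffRiemannianBundle 𝓘(ℝ, E) ∞ E (fun x : M => TangentSpace 𝓘(ℝ, E) x)]

omit [FiniteDimensional ℝ E]
  [IsContMDiffRiemannianBundle 𝓘(ℝ, E) ∞ E (fun x : M => TangentSpace 𝓘(ℝ, E) x)] in
theorem inner_constField_eq (x₀ : M) (a b : E) :
    (fun x => tangentInner (E := E) x (constField x₀ a x) (constField x₀ b x)) ∘ (extChartAt 𝓘(ℝ, E) x₀).symm
      =ᶠ[𝓝 (extChartAt 𝓘(ℝ, E) x₀ x₀)] fun y => metricInChart x₀ y a b := by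
  filter_upwards [extChartAt_target_mem_nhds (I := 𝓘(ℝ, E)) x₀] with y hy
  have h := metricInChart_apply ((extChartAt 𝓘(ℝ, E) x₀).map_target hy) a b
  rw [(extChartAt 𝓘(ℝ, E) x₀).right_inv hy] at h
  exact h.symm

omit [FiniteDimensional ℝ E] in
theorem contMDiffAt_tangentInner {x : M} {Y Z : ∀ y : M, TangentSpace 𝓘(ℝ, E) y}
    (hY : SmoothFieldAt 𝓘(ℝ, E) Y x) (hZ : SmoothFieldAt 𝓘(ℝ, E) Z x) :
    ContMDiffAt 𝓘(ℝ, E) 𝓘(ℝ, ℝ) ∞ (fun y => tangentInner (E := E) y (Y y) (Z y)) x :=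
  ContMDiffAt.inner_bundle (IB := 𝓘(ℝ, E)) (IM := 𝓘(ℝ, E)) (n := ∞) (F := E)
    (E := fun x : M => TangentSpace 𝓘(ℝ, E) x) (b := fun x => x) (v := Y) (w := Z) hY hZ

theorem contDiffAt_metricInChart (x₀ : M) :
    ContDiffAt ℝ ∞ (metricInChart x₀) (extChartAt 𝓘(ℝ, E) x₀ x₀) := by
  refine contDiffAt_clm_apply_iff.2 fun a => contDiffAt_clm_apply_iff.2 fun b => ?_
  refine ContDiffAt.congr_of_eventuallyEq ?_ (inner_constField_eq x₀ a b).symm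
  refine (contMDiffAt_iff_contDiffAt_symm 𝓘(ℝ, E) _ _).1 ?_
  exact contMDiffAt_tangentInner (smoothFieldAt_constField x₀ a) (smoothFieldAt_constField x₀ b)

theorem eventually_differentiableAt_metricInChart (x₀ : M) :
    ∀ᶠ x in 𝓝 x₀, DifferentiableAt ℝ (metricInChart x₀) (extChartAt 𝓘(ℝ, E) x₀ x) := by
  have h := (((contDiffAt_metricInChart (E := E) x₀).of_le (m := 1) (by decide)).eventually (by simp))
  filter_upwards [(continuousAt_extChartAt (I := 𝓘(ℝ, E)) x₀).eventually h] with x hx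
  exact hx.differentiableAt (by simp)

/-! ### The Christoffel symbols -/

/-- The sum is the Riesz representative of `f`. Hence the vector defining `christoffel` does not
depend on the orthonormal basis. -/
theorem _root_.OrthonormalBasis.inner_sum_smul_eq {V ι : Type*} [NormedAddCommGroup V]
    [InnerProductSpace ℝ V] [Fintype ι] (e : OrthonormalBasis ι ℝ V) (f : V →ₗ[ℝ] ℝ) (c : V) :
    inner ℝ (∑ k, f (e k) • e k) c = f c := by
  conv_rhs => rw [← e.sum_repr' c]
  simp [sum_inner, inner_smul_left, mul_comm]

/-- The Christoffel symbols at `x` as a bilinear map of `E`. -/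
def christoffelMap (x : M) : E →ₗ[ℝ] E →ₗ[ℝ] E := christoffel x

omit [IsContMDiffRiemannianBundle 𝓘(ℝ, E) ∞ E (fun x : M => TangentSpace 𝓘(ℝ, E) x)] in
theorem metricInChart_christoffel (x : M)
    (a b c : E) :
    metricInChart x (extChartAt 𝓘(ℝ, E) x x) (christoffelMap x a b) c =
      christoffelFirst (bilinDeriv (metricInChart x) (extChartAt 𝓘(ℝ, E) x x)) a b c := by
  rw [metricInChart_self]
  exact (stdOrthonormalBasis ℝ (TangentSpace 𝓘(ℝ, E) x)).inner_sum_smul_eq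
    (christoffelFirstL (bilinDeriv (metricInChart x) (extChartAt 𝓘(ℝ, E) x x)) a b : E →ₗ[ℝ] ℝ) c

/-- The transformation law of the Christoffel symbols. -/
theorem eventually_christoffel_transition (x₀ : M) :
    ∀ᶠ x in 𝓝 x₀, ∃ hx : x ∈ (extChartAt 𝓘(ℝ, E) x₀).source, ∀ a b,
      transitionEquiv hx (christoffelMap x a b) =
        christoffelSecond (metricInChart x₀) (extChartAt 𝓘(ℝ, E) x₀ x) (transitionEquiv hx a)
          (transitionEquiv hx b) +
        fderiv ℝ (fderiv ℝ (transition x₀ x)) (extChartAt 𝓘(ℝ, E) x x) a b := by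
  filter_upwards [eventually_differentiableAt_metricInChart (E := E) x₀,
    extChartAt_source_mem_nhds (I := 𝓘(ℝ, E)) x₀] with x hd hx
  refine ⟨hx, fun a b => ?_⟩
  have hinv := metricInChart_isInvertible ((extChartAt 𝓘(ℝ, E) x₀).map_source hx)
  have hinj : Function.Injective (metricInChart x₀ (extChartAt 𝓘(ℝ, E) x₀ x)) := by
    obtain ⟨e, he⟩ := hinv
    rw [← he]
    exact e.injective
  -- Both sides are lowered with the metric in the chart at `x₀` and tested on images of the
  -- transition derivative, which is onto; the claim then becomes `christoffelFirst_pullback`.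
  apply hinj
  ext c
  obtain ⟨c, rfl⟩ := (transitionEquiv hx).surjective c
  rw [← transition_self] at hd
  have h1 := christoffelFirst_pullback (contDiffAt_transition hx) hd
    ((contDiffAt_metricInChart x).differentiableAt (by simp)) (eventually_metricInChart_eq hx)
    (metricInChart_symm _ _) a b c
  simp only [fderiv_transition_apply hx, transition_self] at h1
  rw [metricInChart_transition hx, map_add, add_apply, metric_christoffelSecond hinv, ← h1,
    ← metricInChart_christoffel, metricInChart_self]

/-! ### Killing fields in charts -/

omit [FiniteDimensional ℝ E]
  [IsContMDiffRiemannianBundle 𝓘(ℝ, E) ∞ E (fun x : M => TangentSpace 𝓘(ℝ, E) x)] in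
theorem IsKilling.mvfderiv_tangentInner {X : ∀ x : M, TangentSpace 𝓘(ℝ, E) x} (hX : IsKilling X)
    {x : M} {Y Z : ∀ y : M, TangentSpace 𝓘(ℝ, E) y}
    (hY : SmoothFieldAt 𝓘(ℝ, E) Y x) (hZ : SmoothFieldAt 𝓘(ℝ, E) Z x) :
    mvfderiv 𝓘(ℝ, E) (fun y => tangentInner (E := E) y (Y y) (Z y)) x (X x) =
      tangentInner (E := E) x (VectorField.mlieBracket 𝓘(ℝ, E) X Y x) (Z x) +
      tangentInner (E := E) x (Y x) (VectorField.mlieBracket 𝓘(ℝ, E) X Z x) :=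
  hX.2 x Y Z hY hZ

/-- The Killing identity is applied to fields with constant components in the chart at `x`. Their
bracket with `X` at the centre is `-DX a`, and the derivative of their inner product is that of a
metric coefficient. -/
theorem IsKilling.killingForm_self {X : ∀ x : M, TangentSpace 𝓘(ℝ, E) x} (hX : IsKilling X)
    (x : M) (a b : E) :
    killingForm (metricInChart x) (coordField 𝓘(ℝ, E) x X) (extChartAt 𝓘(ℝ, E) x x) a b = 0 := by
  have hsm := contMDiffAt_tangentInner (smoothFieldAt_constField x a)
    (smoothFieldAt_constField x b)
  have hbr : ∀ a : E, @Eq E (VectorField.mlieBracket 𝓘(ℝ, E) X (constField x a) x) <|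
      -fderiv ℝ (coordField 𝓘(ℝ, E) x X) (extChartAt 𝓘(ℝ, E) x x) a := fun a => by
    rw [mlieBracket_eq_lieBracket_coordField, VectorField.lieBracket,
      (coordField_constField x a).fderiv_eq, (coordField_constField x a).self_of_nhds]
    simp
  have h := hX.mvfderiv_tangentInner (smoothFieldAt_constField x a) (smoothFieldAt_constField x b)
  rw [hbr, hbr, constField_self, constField_self, mvfderiv_eq_fderiv _ hsm] at h
  have h' := (inner_constField_eq x a b).fderiv_eq (𝕜 := ℝ)
  have hd := bilinDeriv_apply ((contDiffAt_metricInChart x).differentiableAt (by simp))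
    (coordField 𝓘(ℝ, E) x X (extChartAt 𝓘(ℝ, E) x x)) a b
  rw [← h', coordField_self] at hd
  rw [killingForm, coordField_self, metricInChart_self, metricInChart_self]
  have h2 := hd.trans h
  rw [h2, tangentInner_neg_left, tangentInner_neg_right]
  ring

/-- Differentiating the Killing equation requires it on a neighbourhood in one fixed chart. At each
nearby `x` it is known in the chart preferred at `x`, and `killingForm_pullback` carries it to the
chart at `x₀`. -/
theorem IsKilling.eventually_killingForm {X : ∀ x : M, TangentSpace 𝓘(ℝ, E) x} (hX : IsKilling X)
    (x₀ : M) : ∀ᶠ y in 𝓝 (extChartAt 𝓘(ℝ, E) x₀ x₀), ∀ a b,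
      killingForm (metricInChart x₀) (coordField 𝓘(ℝ, E) x₀ X) y a b = 0 := by
  have h : ∀ᶠ x in 𝓝 x₀, ∀ a b, killingForm (metricInChart x₀) (coordField 𝓘(ℝ, E) x₀ X)
      (extChartAt 𝓘(ℝ, E) x₀ x) a b = 0 := by
    filter_upwards [eventually_differentiableAt_metricInChart (E := E) x₀,
      eventually_differentiableAt_coordField (hX.1 x₀),
      extChartAt_source_mem_nhds (I := 𝓘(ℝ, E)) x₀] with x hd hd' hx a b
    obtain ⟨a, rfl⟩ := (transitionEquiv hx).surjective a
    obtain ⟨b, rfl⟩ := (transitionEquiv hx).surjective b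
    rw [← transition_self] at hd hd'
    have h1 := killingForm_pullback (contDiffAt_transition hx) hd
      ((contDiffAt_metricInChart x).differentiableAt (by simp)) (eventually_metricInChart_eq hx)
      hd' (((smoothFieldAt_iff _ _ _).1 (hX.1 x)).differentiableAt (by simp))
      (eventually_coordField_eq X hx) a b
    rw [hX.killingForm_self (E := E)] at h1
    simpa only [fderiv_transition_apply hx, transition_self] using h1.symm
  have h2 := (continuousAt_extChartAt_symm (I := 𝓘(ℝ, E)) x₀).eventually
    (by rwa [extChartAt_to_inv])
  filter_upwards [h2, extChartAt_target_mem_nhds (I := 𝓘(ℝ, E)) x₀] with y h3 h4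
  rwa [(extChartAt 𝓘(ℝ, E) x₀).right_inv h4] at h3

end MetricInChart

/-! ## Volume forms -/

section Algebra

/-- The alternating form `(w_j) ↦ ∑ⱼ η(w₁, …, A wⱼ, …)`. -/
def alternatingDerivation {V ι : Type*} [AddCommGroup V] [Module ℝ V] [Fintype ι] [DecidableEq ι]
    (η : V [⋀^ι]→ₗ[ℝ] ℝ) (A : V →ₗ[ℝ] V) : V [⋀^ι]→ₗ[ℝ] ℝ where
  toMultilinearMap := ∑ j, η.toMultilinearMap.compLinearMap
    (Function.update (fun _ => LinearMap.id) j A)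
  map_eq_zero_of_eq' := by
    intro v i k hv hik
    have hu : ∀ j, (fun l => Function.update (fun _ => LinearMap.id) j A l (v l)) =
        Function.update v j (A (v j)) := fun j => by
      ext l
      by_cases h : l = j
      · subst h; simp
      · simp [h]
    change (∑ j, η.toMultilinearMap.compLinearMap
      (Function.update (fun _ => LinearMap.id) j A)) v = 0
    simp only [sum_apply, MultilinearMap.compLinearMap_apply, hu,
      AlternatingMap.coe_multilinearMap]
    -- When `v i = v k`, every term with `j` different from `i` and `k` still has two equal
    -- arguments; the two remaining terms differ by a transposition and cancel.
    rw [← Finset.add_sum_erase _ _ (Finset.mem_univ i),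
      ← Finset.add_sum_erase _ _ (Finset.mem_erase.2 ⟨hik.symm, Finset.mem_univ k⟩),
      Finset.sum_eq_zero, add_zero]
    · have h1 : Function.update v k (A (v k)) =
          Function.update v i (A (v i)) ∘ Equiv.swap i k := by
        ext l
        by_cases hl : l = k
        · subst hl; simp [hv]
        by_cases hl' : l = i
        · subst hl'; simp [hv, hik, hik.symm]
        · simp [hl, hl', Equiv.swap_apply_of_ne_of_ne hl' hl]
      rw [h1, AlternatingMap.map_swap _ _ hik]
      ring
    · intro j hj
      simp only [Finset.mem_erase, Finset.mem_univ, and_true] at hj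
      refine η.map_eq_zero_of_eq _ ?_ hik
      simp [Ne.symm hj.1, Ne.symm hj.2, hv]

theorem alternatingDerivation_apply {V ι : Type*} [AddCommGroup V] [Module ℝ V] [Fintype ι]
    [DecidableEq ι] (η : V [⋀^ι]→ₗ[ℝ] ℝ) (A : V →ₗ[ℝ] V) (v : ι → V) :
    alternatingDerivation η A v = ∑ j, η (Function.update v j (A (v j))) := by
  have hu : ∀ j, (fun l => Function.update (fun _ => LinearMap.id) j A l (v l)) =
      Function.update v j (A (v j)) := fun j => by
    ext l
    by_cases h : l = j
    · subst h; simp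
    · simp [h]
  change (∑ j, η.toMultilinearMap.compLinearMap (Function.update (fun _ => LinearMap.id) j A)) v = _
  simp only [sum_apply, MultilinearMap.compLinearMap_apply, hu,
    AlternatingMap.coe_multilinearMap]

/-- The square of the volume form is the Gram determinant. -/
theorem volumeForm_sq {V : Type*} [NormedAddCommGroup V] [InnerProductSpace ℝ V] {m : ℕ}
    [Fact (Module.finrank ℝ V = m + 1)] (o : Orientation ℝ V (Fin (m + 1)))
    (w : Fin (m + 1) → V) :
    o.volumeForm w ^ 2 = (Matrix.of fun i j => inner ℝ (w i) (w j)).det := by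
  have : FiniteDimensional ℝ V := .of_fact_finrank_eq_succ m
  let b := o.finOrthonormalBasis m.succ_pos Fact.out
  have h : (Matrix.of fun i j => inner ℝ (w i) (w j)) =
      (b.toBasis.toMatrix w).transpose * b.toBasis.toMatrix w := by
    ext i j
    simp only [Matrix.of_apply, Matrix.mul_apply, Matrix.transpose_apply,
      Module.Basis.toMatrix_apply, OrthonormalBasis.coe_toBasis_repr_apply,
      OrthonormalBasis.repr_apply_apply]
    rw [← b.sum_inner_mul_inner]
    simp [real_inner_comm]
  rw [h, Matrix.det_mul, Matrix.det_transpose, ← sq_abs, o.volumeForm_robust' b, sq_abs,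
    Module.Basis.det_apply, sq]

theorem volumeForm_pos {V : Type*} [NormedAddCommGroup V] [InnerProductSpace ℝ V] {m : ℕ}
    [Fact (Module.finrank ℝ V = m + 1)] (o : Orientation ℝ V (Fin (m + 1)))
    (b : Module.Basis (Fin (m + 1)) ℝ V) (hb : b.orientation = o) : 0 < o.volumeForm b := by
  have : FiniteDimensional ℝ V := .of_fact_finrank_eq_succ m
  rw [o.volumeForm_robust (o.finOrthonormalBasis m.succ_pos Fact.out)
    (o.finOrthonormalBasis_orientation _ _), ← Module.Basis.orientation_eq_iff_det_pos, hb]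
  exact o.finOrthonormalBasis_orientation _ _

end Algebra

/-! ### Derivatives of determinants and of the volume in coordinates -/

section VolumeCalculus

variable {E : Type*} [NormedAddCommGroup E] [NormedSpace ℝ E] [FiniteDimensional ℝ E]
  {ι : Type*} [Fintype ι] [DecidableEq ι]

/-- The determinant with respect to a basis, as a continuous multilinear map. -/
def detCLM (e : Module.Basis ι ℝ E) : ContinuousMultilinearMap ℝ (fun _ : ι => E) ℝ where
  toMultilinearMap := e.det.toMultilinearMap
  cont := by
    change Continuous fun v : ι → E => (e.toMatrix v).det
    refine Continuous.matrix_det (continuous_pi fun i => continuous_pi fun j => ?_)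
    exact (LinearMap.continuous_of_finiteDimensional (e.coord i)).comp (continuous_apply j)

theorem detCLM_apply (e : Module.Basis ι ℝ E) (v : ι → E) : detCLM e v = e.det v := rfl

theorem contDiffAt_matrix_det {D : Type*} [NormedAddCommGroup D] [NormedSpace ℝ D] {n : WithTop ℕ∞}
    {A : D → Matrix ι ι ℝ} {x : D} (hA : ∀ i j, ContDiffAt ℝ n (fun x => A x i j) x) :
    ContDiffAt ℝ n (fun x => (A x).det) x := by
  simp only [Matrix.det_apply]
  refine ContDiffAt.sum fun σ _ => ContDiffAt.const_smul _ ?_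
  exact contDiffAt_prod fun i _ => hA _ _

theorem contDiffAt_basis_det {D : Type*} [NormedAddCommGroup D] [NormedSpace ℝ D]
    (e : Module.Basis ι ℝ E) {S : D → ι → E} {x : D}
    (hS : ∀ j, ContDiffAt ℝ ∞ (fun x => S x j) x) : ContDiffAt ℝ ∞ (fun x => e.det (S x)) x := by
  simp only [Module.Basis.det_apply]
  refine contDiffAt_matrix_det fun i j => ?_
  exact (LinearMap.toContinuousLinearMap (e.coord i)).contDiff.contDiffAt.comp x (hS j)

omit [FiniteDimensional ℝ E] in
theorem contDiffAt_gram {D : Type*} [NormedAddCommGroup D] [NormedSpace ℝ D]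
    {g : D → E →L[ℝ] E →L[ℝ] ℝ} {S : D → ι → E} {x : D} (hg : ContDiffAt ℝ ∞ g x)
    (hS : ∀ j, ContDiffAt ℝ ∞ (fun x => S x j) x) :
    ContDiffAt ℝ ∞ (fun x => (Matrix.of fun i j => g x (S x i) (S x j)).det) x := by
  refine contDiffAt_matrix_det fun i j => ?_
  simp only [Matrix.of_apply]
  exact (hg.clm_apply (hS i)).clm_apply (hS j)

/-- A determinant whose entries are critical at a point is critical there. -/
theorem hasDerivAt_det_zero {A : ℝ → Matrix ι ι ℝ} {t : ℝ}
    (hA : ∀ i j, HasDerivAt (fun s => A s i j) 0 t) : HasDerivAt (fun s => (A s).det) 0 t := by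
  simp only [Matrix.det_apply]
  have h : ∀ σ : Equiv.Perm ι, HasDerivAt
      (fun s => Equiv.Perm.sign σ • ∏ i, A s (σ i) i) 0 t := fun σ => by
    have h1 := HasDerivAt.fun_finsetProd (u := Finset.univ) (f := fun i s => A s (σ i) i)
      (f' := fun _ => 0) (x := t) fun i _ => hA (σ i) i
    simp only [smul_zero, Finset.sum_const_zero] at h1
    simpa using! h1.const_smul (Equiv.Perm.sign σ)
  simpa using HasDerivAt.fun_sum (u := Finset.univ) fun σ _ => h σ

/-- A Killing field preserves the volume form, in coordinates. -/
theorem fderiv_volume_of_killing {g : E → E →L[ℝ] E →L[ℝ] ℝ} {X : E → E} {c : E → ℝ} {y : E}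
    (e : Module.Basis ι ℝ E) (hg : DifferentiableAt ℝ g y) (hc : DifferentiableAt ℝ c y)
    (hc0 : c y ≠ 0)
    (hsq : ∀ᶠ y in 𝓝 y, ∀ u : ι → E,
      (c y * e.det u) ^ 2 = (Matrix.of fun i j => g y (u i) (u j)).det)
    (hK : ∀ a b, killingForm g X y a b = 0) (u : ι → E) :
    fderiv ℝ c y (X y) * e.det u + c y * ∑ j, e.det (Function.update u j (fderiv ℝ X y (u j))) =
      0 := by
  -- The expression is an alternating form of top degree in `u`, so it vanishes as soon as it
  -- vanishes on the basis `e`.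
  set D : E [⋀^ι]→ₗ[ℝ] ℝ := fderiv ℝ c y (X y) • e.det +
    c y • alternatingDerivation e.det (fderiv ℝ X y : E →ₗ[ℝ] E) with hD
  have hDu : ∀ u, D u = fderiv ℝ c y (X y) * e.det u +
      c y * ∑ j, e.det (Function.update u j (fderiv ℝ X y (u j))) := fun u => by
    simp [hD, alternatingDerivation_apply]
  rw [← hDu]
  suffices h : D e = 0 by rw [D.eq_smul_basis_det e, h]; simp
  have hl : ∀ a b : E, HasDerivAt (fun t : ℝ => a + t • b) b 0 := fun a b => by
    simpa using ((hasDerivAt_id (0 : ℝ)).smul_const b).const_add a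
  have hy : y = y + (0 : ℝ) • X y := by simp
  have hct : HasDerivAt (fun t : ℝ => c (y + t • X y)) (fderiv ℝ c y (X y)) 0 := by
    refine HasFDerivAt.comp_hasDerivAt 0 (l := c) ?_ (hl y (X y))
    rw [← hy]; exact hc.hasFDerivAt
  have hgt : HasDerivAt (fun t : ℝ => g (y + t • X y)) (bilinDeriv g y (X y)) 0 := by
    refine HasFDerivAt.comp_hasDerivAt 0 (l := g) ?_ (hl y (X y))
    rw [← hy]; exact hg.hasFDerivAt
  -- The basis is carried along the line `y + t X` by `1 + t DX`, the first-order approximation of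
  -- the flow of `X`. Under this motion the derivative of each Gram entry at `0` is the Killing
  -- form.
  have hut : HasDerivAt (fun t : ℝ => fun i => e i + t • fderiv ℝ X y (e i))
      (fun i => fderiv ℝ X y (e i)) 0 := hasDerivAt_pi.2 fun i => hl _ _
  have hdt : HasDerivAt (fun t : ℝ => detCLM e fun i => e i + t • fderiv ℝ X y (e i))
      (∑ j, e.det (Function.update e j (fderiv ℝ X y (e j)))) 0 := by
    have h1 := ((detCLM e).hasFDerivAt (x := fun i => e i + (0 : ℝ) • fderiv ℝ X y (e i)))
    have h2 := h1.comp_hasDerivAt (0 : ℝ) hut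
    simp only [ContinuousMultilinearMap.linearDeriv_apply, zero_smul, add_zero] at h2
    exact h2
  have hF := (hct.mul hdt).pow 2
  have hM : HasDerivAt (fun t : ℝ => (Matrix.of fun i j => g (y + t • X y)
      (e i + t • fderiv ℝ X y (e i)) (e j + t • fderiv ℝ X y (e j))).det) 0 0 := by
    refine hasDerivAt_det_zero fun i j => ?_
    have h1 := (hgt.clm_apply (hl (e i) (fderiv ℝ X y (e i)))).clm_apply
      (hl (e j) (fderiv ℝ X y (e j)))
    refine h1.congr_deriv ?_
    have h2 := hK (e i) (e j)
    simp only [killingForm] at h2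
    simpa using h2
  have hcont : ContinuousAt (fun t : ℝ => y + t • X y) 0 := (hl y (X y)).continuousAt
  have htend : Tendsto (fun t : ℝ => y + t • X y) (𝓝 0) (𝓝 y) := by simpa using hcont.tendsto
  have hev := htend.eventually hsq
  -- The derivative of the squared volume is `2 (c det e) D(e)`, and it is zero as the derivative of
  -- the Gram determinant. The factors `c` and `det e` are nonzero.
  have huniq := hF.unique (hM.congr_of_eventuallyEq (hev.mono fun t ht => ht _))
  simp [detCLM_apply, hc0] at huniq
  rw [hDu]
  exact huniq.resolve_left e.det_ne_zero

end VolumeCalculus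

/-! ### The Riemannian volume form in a chart of `M` -/

section VolumeInChart

variable {n : ℕ} {E : Type*} [NormedAddCommGroup E] [NormedSpace ℝ E] [FiniteDimensional ℝ E]
  [Fact (Module.finrank ℝ E = n + 1)]
  {M : Type*} [TopologicalSpace M] [ChartedSpace E M] [IsManifold 𝓘(ℝ, E) ∞ M]
  [RiemannianBundle (fun x : M => TangentSpace 𝓘(ℝ, E) x)]

/-- The volume form at `x` as an alternating form of `E`. -/
def volMap (o : ManifoldOrientation n E M) (x : M) : E [⋀^Fin (n + 1)]→ₗ[ℝ] ℝ := volForm o x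

/-- The coefficient of the volume form in the preferred chart at `x₀`, for a basis `e` of `E`. -/
def volCoeff (o : ManifoldOrientation n E M) (x₀ : M) (e : Module.Basis (Fin (n + 1)) ℝ E)
    (y : E) : ℝ :=
  volMap o ((extChartAt 𝓘(ℝ, E) x₀).symm y) fun j =>
    tangentCoordChange 𝓘(ℝ, E) x₀ ((extChartAt 𝓘(ℝ, E) x₀).symm y)
      ((extChartAt 𝓘(ℝ, E) x₀).symm y) (e j)

omit [FiniteDimensional ℝ E] in
theorem volMap_eq (o : ManifoldOrientation n E M) (e : Module.Basis (Fin (n + 1)) ℝ E) {x₀ x : M}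
    (hx : x ∈ (extChartAt 𝓘(ℝ, E) x₀).source) (w : Fin (n + 1) → E) :
    volMap o x w = volCoeff o x₀ e (extChartAt 𝓘(ℝ, E) x₀ x) *
      e.det fun j => transitionEquiv hx (w j) := by
  have h := DFunLike.congr_fun (((volMap o x).compLinearMap
    ((transitionEquiv hx).symm : E →ₗ[ℝ] E)).eq_smul_basis_det e) fun j => transitionEquiv hx (w j)
  simp only [AlternatingMap.compLinearMap_apply, AlternatingMap.smul_apply, smul_eq_mul] at h
  have h1 : (fun j => ((transitionEquiv hx).symm : E →ₗ[ℝ] E) (transitionEquiv hx (w j))) = w :=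
    funext fun j => (transitionEquiv hx).symm_apply_apply (w j)
  rw [h1] at h
  rw [h, volCoeff, (extChartAt 𝓘(ℝ, E) x₀).left_inv hx]
  rfl

omit [FiniteDimensional ℝ E] in
theorem volMap_sq (o : ManifoldOrientation n E M) (x : M)
    (w : Fin (n + 1) → E) :
    volMap o x w ^ 2 = (Matrix.of fun i j => tangentInner x (w i) (w j)).det :=
  volumeForm_sq (V := TangentSpace 𝓘(ℝ, E) x) (o.atPoint x) w

omit [FiniteDimensional ℝ E] in
theorem volCoeff_sq (o : ManifoldOrientation n E M) (e : Module.Basis (Fin (n + 1)) ℝ E) {x₀ : M}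
    {y : E} (hy : y ∈ (extChartAt 𝓘(ℝ, E) x₀).target) (u : Fin (n + 1) → E) :
    (volCoeff o x₀ e y * e.det u) ^ 2 =
      (Matrix.of fun i j => metricInChart x₀ y (u i) (u j)).det := by
  have hx := (extChartAt 𝓘(ℝ, E) x₀).map_target hy
  have h := volMap_eq o e hx fun j => (transitionEquiv hx).symm (u j)
  simp only [ContinuousLinearEquiv.apply_symm_apply, (extChartAt 𝓘(ℝ, E) x₀).right_inv hy] at h
  rw [← h, volMap_sq]
  congr 1
  ext i j
  simp only [Matrix.of_apply]
  rw [← metricInChart_transition hx, ContinuousLinearEquiv.apply_symm_apply,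
    ContinuousLinearEquiv.apply_symm_apply, (extChartAt 𝓘(ℝ, E) x₀).right_inv hy]

omit [FiniteDimensional ℝ E] in
/-- Near every point there is a smooth positively oriented frame, given by its components. -/
theorem exists_frame_components (o : ManifoldOrientation n E M)
    (e : Module.Basis (Fin (n + 1)) ℝ E) (x₀ : M) :
    ∃ S : E → Fin (n + 1) → E,
      (∀ j, ContDiffAt ℝ ∞ (fun y => S y j) (extChartAt 𝓘(ℝ, E) x₀ x₀)) ∧
      ∀ᶠ y in 𝓝 (extChartAt 𝓘(ℝ, E) x₀ x₀), 0 < volCoeff o x₀ e y * e.det (S y) := by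
  obtain ⟨s, hs, hpos⟩ := o.exists_frame x₀
  refine ⟨fun y j => coordField 𝓘(ℝ, E) x₀ (s j) y, fun j => (smoothFieldAt_iff _ _ _).1 (hs j), ?_⟩
  have h2 := (continuousAt_extChartAt_symm (I := 𝓘(ℝ, E)) x₀).eventually
    (by rwa [extChartAt_to_inv])
  filter_upwards [h2, extChartAt_target_mem_nhds (I := 𝓘(ℝ, E)) x₀] with y ⟨b, hb, hbo⟩ hy
  have hx := (extChartAt 𝓘(ℝ, E) x₀).map_target hy
  have h3 : 0 < volMap o ((extChartAt 𝓘(ℝ, E) x₀).symm y) b := volumeForm_pos _ b hbo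
  have h4 := volMap_eq o e hx fun j => b j
  rw [(extChartAt 𝓘(ℝ, E) x₀).right_inv hy] at h4
  have h5 : (fun j => transitionEquiv hx (b j)) = fun j => coordField 𝓘(ℝ, E) x₀ (s j) y := by
    funext j
    rw [hb j]
    rfl
  rw [h5] at h4
  rw [← h4]
  exact h3

omit [FiniteDimensional ℝ E] in
theorem volCoeff_ne_zero (o : ManifoldOrientation n E M) (e : Module.Basis (Fin (n + 1)) ℝ E)
    (x₀ : M) : volCoeff o x₀ e (extChartAt 𝓘(ℝ, E) x₀ x₀) ≠ 0 := by
  obtain ⟨S, -, hS⟩ := exists_frame_components o e x₀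
  exact left_ne_zero_of_mul hS.self_of_nhds.ne'

variable [IsContMDiffRiemannianBundle 𝓘(ℝ, E) ∞ E (fun x : M => TangentSpace 𝓘(ℝ, E) x)]

/-- The Gram identity determines the coefficient only up to sign. On a smooth positively oriented
frame the volume is positive, hence it is the square root of a nonvanishing smooth Gram determinant;
dividing by the determinant of the frame gives the coefficient. -/
theorem contDiffAt_volCoeff (o : ManifoldOrientation n E M)
    (e : Module.Basis (Fin (n + 1)) ℝ E) (x₀ : M) :
    ContDiffAt ℝ ∞ (volCoeff o x₀ e) (extChartAt 𝓘(ℝ, E) x₀ x₀) := by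
  obtain ⟨S, hS, hpos⟩ := exists_frame_components o e x₀
  set y₀ := extChartAt 𝓘(ℝ, E) x₀ x₀ with hy₀
  have hdet : ContDiffAt ℝ ∞ (fun y => e.det (S y)) y₀ := contDiffAt_basis_det e hS
  have hgram : ContDiffAt ℝ ∞ (fun y => (Matrix.of fun i j =>
      metricInChart x₀ y (S y i) (S y j)).det) y₀ :=
    contDiffAt_gram (contDiffAt_metricInChart x₀) hS
  have hsq : ∀ᶠ y in 𝓝 y₀, (volCoeff o x₀ e y * e.det (S y)) ^ 2 =
      (Matrix.of fun i j => metricInChart x₀ y (S y i) (S y j)).det := by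
    filter_upwards [extChartAt_target_mem_nhds (I := 𝓘(ℝ, E)) x₀] with y hy
    exact volCoeff_sq o e hy _
  have h0 := hpos.self_of_nhds
  have hgpos : (Matrix.of fun i j => metricInChart x₀ y₀ (S y₀ i) (S y₀ j)).det ≠ 0 := by
    rw [← hsq.self_of_nhds]; exact (pow_pos h0 2).ne'
  have hquot := (hgram.sqrt hgpos).fun_div hdet (right_ne_zero_of_mul h0.ne')
  refine hquot.congr_of_eventuallyEq ?_
  filter_upwards [hpos, hsq] with y h1 h2
  rw [← h2, Real.sqrt_sq h1.le, mul_div_cancel_right₀ _ (right_ne_zero_of_mul h1.ne')]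

/-- A Killing field preserves the volume form. -/
theorem fderiv_volCoeff (o : ManifoldOrientation n E M) (e : Module.Basis (Fin (n + 1)) ℝ E)
    {X : ∀ x : M, TangentSpace 𝓘(ℝ, E) x} (hX : IsKilling X) (x₀ : M) (u : Fin (n + 1) → E) :
    fderiv ℝ (volCoeff o x₀ e) (extChartAt 𝓘(ℝ, E) x₀ x₀)
      (coordField 𝓘(ℝ, E) x₀ X (extChartAt 𝓘(ℝ, E) x₀ x₀)) * e.det u +
      volCoeff o x₀ e (extChartAt 𝓘(ℝ, E) x₀ x₀) * ∑ j, e.det (Function.update u j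
        (fderiv ℝ (coordField 𝓘(ℝ, E) x₀ X) (extChartAt 𝓘(ℝ, E) x₀ x₀) (u j))) = 0 := by
  refine fderiv_volume_of_killing e ((contDiffAt_metricInChart x₀).differentiableAt (by simp))
    ((contDiffAt_volCoeff o e x₀).differentiableAt (by simp)) (volCoeff_ne_zero o e x₀) ?_
    (hX.killingForm_self x₀) u
  filter_upwards [extChartAt_target_mem_nhds (I := 𝓘(ℝ, E)) x₀] with y hy
  exact volCoeff_sq o e hy

end VolumeInChart

/-! ## Lie brackets with the complete lift in coordinates -/

section LiftCalculus

variable {E : Type*} [NormedAddCommGroup E] [NormedSpace ℝ E]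

/-- The base component of the bracket depends on `Z` only through its own base component, because
the base component of the lift is constant along the fibres. -/
theorem lieBracket_coordCompleteLift_fst {X : E → E} {Z : E × E → E × E} {z : E × E}
    (hX : ContDiffAt ℝ ∞ X z.1) (hZ : DifferentiableAt ℝ Z z) :
    (VectorField.lieBracket ℝ (coordCompleteLift X) Z z).1 =
      fderiv ℝ (fun z => (Z z).1) z (coordCompleteLift X z) - fderiv ℝ X z.1 (Z z).1 := by
  rw [VectorField.lieBracket, fderiv_coordCompleteLift hX, hZ.hasFDerivAt.fst.fderiv]
  simp

theorem lieBracket_coordMirror {X : E → E} {Z : E × E → E × E} {z : E × E}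
    (hX : ContDiffAt ℝ ∞ X z.1) (hZ : DifferentiableAt ℝ Z z) :
    VectorField.lieBracket ℝ (coordCompleteLift X) (fun z => ((0 : E), (Z z).1)) z =
      (0, (VectorField.lieBracket ℝ (coordCompleteLift X) Z z).1) := by
  have h := (hasFDerivAt_const (𝕜 := ℝ) (0 : E) z).prodMk hZ.hasFDerivAt.fst
  rw [lieBracket_coordCompleteLift_fst hX hZ, VectorField.lieBracket, fderiv_coordCompleteLift hX,
    h.fderiv, hZ.hasFDerivAt.fst.fderiv]
  simp

/-- The field is the Euler field of the fibres, and the lift has base component constant and fibre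
component linear in `v`: it is homogeneous under fibre dilations. -/
theorem lieBracket_coordCanonical {X : E → E} {z : E × E} (hX : ContDiffAt ℝ ∞ X z.1) :
    VectorField.lieBracket ℝ (coordCompleteLift X) (fun z => ((0 : E), z.2)) z = 0 := by
  have hs : HasFDerivAt (Prod.snd : E × E → E) (ContinuousLinearMap.snd ℝ E E) z :=
    hasFDerivAt_snd
  have h := (hasFDerivAt_const (𝕜 := ℝ) (0 : E) z).prodMk hs
  rw [VectorField.lieBracket, fderiv_coordCompleteLift hX, h.fderiv]
  simp [coordCompleteLift]

/-- By the Leibniz rule the derivative falls on the coefficient and on each column. The hypothesis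
`h` trades the first part for terms `-DX` in the columns, which complete the column derivatives to
brackets. -/
theorem fderiv_coordVolume [FiniteDimensional ℝ E] {ι : Type*} [Fintype ι] [DecidableEq ι]
    (e : Module.Basis ι ℝ E) {X : E → E} {c : E → ℝ} {Z : ι → E × E → E × E} {z : E × E}
    (hX : ContDiffAt ℝ ∞ X z.1) (hc : DifferentiableAt ℝ c z.1)
    (hZ : ∀ j, DifferentiableAt ℝ (Z j) z)
    (h : ∀ u : ι → E, fderiv ℝ c z.1 (X z.1) * e.det u +
      c z.1 * ∑ j, e.det (Function.update u j (fderiv ℝ X z.1 (u j))) = 0) :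
    fderiv ℝ (fun z => c z.1 * e.det fun j => (Z j z).1) z (coordCompleteLift X z) =
      ∑ j, c z.1 * e.det (Function.update (fun l => (Z l z).1) j
        (VectorField.lieBracket ℝ (coordCompleteLift X) (Z j) z).1) := by
  have h1 : HasFDerivAt (fun z : E × E => c z.1) (fderiv ℝ c z.1 ∘L ContinuousLinearMap.fst ℝ E E) z :=
    HasFDerivAt.comp (g := c) z hc.hasFDerivAt hasFDerivAt_fst
  have h2 : HasFDerivAt (fun z => fun j => (Z j z).1) _ z :=
    hasFDerivAt_pi.2 fun j => (hZ j).hasFDerivAt.fst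
  have h3 : HasFDerivAt (fun z => e.det fun j => (Z j z).1) _ z :=
    ((detCLM e).hasFDerivAt (x := fun j => (Z j z).1)).comp z h2
  have h4 := h (fun j => (Z j z).1)
  rw [(h1.fun_mul h3).fderiv]
  simp only [fun j => lieBracket_coordCompleteLift_fst hX (hZ j), AlternatingMap.map_update_sub,
    mul_sub, Finset.sum_sub_distrib, ← Finset.mul_sum, fun j => (hZ j).hasFDerivAt.fst.fderiv]
  simp [ContinuousMultilinearMap.linearDeriv_apply, detCLM_apply, coordCompleteLift]
  linarith

/-- The base component of the lift differentiates `g`, and its fibre component `DX v` supplies the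
two other terms of the Killing form. This is what makes the lift tangent to the sphere bundles. -/
theorem fderiv_metric_coordCompleteLift {X : E → E} {g : E → E →L[ℝ] E →L[ℝ] ℝ} {z : E × E}
    (hg : DifferentiableAt ℝ g z.1) :
    fderiv ℝ (fun z : E × E => g z.1 z.2 z.2) z (coordCompleteLift X z) =
      killingForm g X z.1 z.2 z.2 := by
  have h1 : HasFDerivAt (fun z : E × E => g z.1) (fderiv ℝ g z.1 ∘L ContinuousLinearMap.fst ℝ E E)
      z := HasFDerivAt.comp (g := g) z hg.hasFDerivAt hasFDerivAt_fst
  have h2 : HasFDerivAt (Prod.snd : E × E → E) (ContinuousLinearMap.snd ℝ E E) z := hasFDerivAt_snd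
  rw [((h1.clm_apply h2).clm_apply h2).fderiv]
  simp only [killingForm, bilinDeriv, coordCompleteLift]
  simp
  ring

end LiftCalculus

/-! ## The fields of `TM` in charts -/

section TangentFields

variable {n : ℕ} {E : Type*} [NormedAddCommGroup E] [NormedSpace ℝ E] [FiniteDimensional ℝ E]
  [Fact (Module.finrank ℝ E = n + 1)]
  {M : Type*} [TopologicalSpace M] [ChartedSpace E M] [IsManifold 𝓘(ℝ, E) ∞ M]

omit [FiniteDimensional ℝ E] in
theorem eventually_extChartAt_tangent (p₀ : TangentBundle 𝓘(ℝ, E) M) :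
    ∀ᶠ z in 𝓝 (extChartAt 𝓘(ℝ, E).tangent p₀ p₀),
      z = extChartAt 𝓘(ℝ, E).tangent p₀ ((extChartAt 𝓘(ℝ, E).tangent p₀).symm z) ∧
      ((extChartAt 𝓘(ℝ, E).tangent p₀).symm z).proj ∈ (extChartAt 𝓘(ℝ, E) p₀.proj).source := by
  filter_upwards [extChartAt_target_mem_nhds (I := 𝓘(ℝ, E).tangent) p₀] with z hz
  exact ⟨((extChartAt 𝓘(ℝ, E).tangent p₀).right_inv hz).symm,
    (mem_extChartAt_tangent_source _ _).1 ((extChartAt 𝓘(ℝ, E).tangent p₀).map_target hz)⟩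

omit [FiniteDimensional ℝ E] in
theorem eventually_proj_extChartAt_symm (p₀ : TangentBundle 𝓘(ℝ, E) M) {P : M → Prop}
    (hP : ∀ᶠ x in 𝓝 p₀.proj, P x) : ∀ᶠ z in 𝓝 (extChartAt 𝓘(ℝ, E).tangent p₀ p₀),
      P ((extChartAt 𝓘(ℝ, E).tangent p₀).symm z).proj := by
  have h1 := continuousAt_extChartAt_symm (I := 𝓘(ℝ, E).tangent) p₀
  have h2 : Tendsto (fun q : TangentBundle 𝓘(ℝ, E) M => q.proj) (𝓝 p₀) (𝓝 p₀.proj) :=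
    (FiberBundle.continuous_proj E _).continuousAt
  refine (h2.comp ?_).eventually hP
  simpa only [ContinuousAt, extChartAt_to_inv] using h1

omit [FiniteDimensional ℝ E] in
theorem tangentCoordChange_mirror {p₀ q : TangentBundle 𝓘(ℝ, E) M}
    (hq : q.proj ∈ (extChartAt 𝓘(ℝ, E) p₀.proj).source) (ζ : E × E) :
    tangentCoordChange 𝓘(ℝ, E).tangent q p₀ q (mirror q ζ) =
      (0, (tangentCoordChange 𝓘(ℝ, E).tangent q p₀ q ζ).1) := by
  refine (tangentCoordChange_tangent_apply hq 0 ζ.1).trans ?_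
  rw [tangentCoordChange_tangent_apply hq ζ.1 ζ.2]
  simp

omit [FiniteDimensional ℝ E] in
theorem tangentCoordChange_canonicalField {p₀ q : TangentBundle 𝓘(ℝ, E) M}
    (hq : q.proj ∈ (extChartAt 𝓘(ℝ, E) p₀.proj).source) :
    tangentCoordChange 𝓘(ℝ, E).tangent q p₀ q (canonicalField q) =
      (0, (extChartAt 𝓘(ℝ, E).tangent p₀ q).2) := by
  refine (tangentCoordChange_tangent_apply hq 0 (fiberVec q)).trans ?_
  rw [extChartAt_tangent_eq hq]
  simp

omit [FiniteDimensional ℝ E] in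
theorem completeLift_eq (X : ∀ x : M, TangentSpace 𝓘(ℝ, E) x) (q : TangentBundle 𝓘(ℝ, E) M) :
    completeLift X q =
      (coordField 𝓘(ℝ, E) q.proj X (extChartAt 𝓘(ℝ, E) q.proj q.proj),
        fderiv ℝ (coordField 𝓘(ℝ, E) q.proj X) (extChartAt 𝓘(ℝ, E) q.proj q.proj)
          (fiberVec q)) := by
  rw [coordField_self]
  rfl

omit [FiniteDimensional ℝ E] in
-- Differentiating the transformation law of the components of `X` produces the term `D²τ(v, X)`,
-- and the coordinate change on `TM` produces `D²τ(X, v)`; these agree by symmetry, so the local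
-- formula has the same form in every chart.
theorem tangentCoordChange_completeLift {X : ∀ x : M, TangentSpace 𝓘(ℝ, E) x}
    {p₀ q : TangentBundle 𝓘(ℝ, E) M} (hX : SmoothFieldAt 𝓘(ℝ, E) X q.proj)
    (hX₀ : DifferentiableAt ℝ (coordField 𝓘(ℝ, E) p₀.proj X)
      (extChartAt 𝓘(ℝ, E) p₀.proj q.proj))
    (hq : q.proj ∈ (extChartAt 𝓘(ℝ, E) p₀.proj).source) :
    tangentCoordChange 𝓘(ℝ, E).tangent q p₀ q (completeLift X q) =
      coordCompleteLift (coordField 𝓘(ℝ, E) p₀.proj X) (extChartAt 𝓘(ℝ, E).tangent p₀ q) := by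
  rw [completeLift_eq]
  refine (tangentCoordChange_tangent_apply hq _ _).trans ?_
  have hτ := contDiffAt_transition hq
  have hs : ∀ u v, fderiv ℝ (fderiv ℝ (transition p₀.proj q.proj))
        (extChartAt 𝓘(ℝ, E) q.proj q.proj) u v =
      fderiv ℝ (fderiv ℝ (transition p₀.proj q.proj)) (extChartAt 𝓘(ℝ, E) q.proj q.proj) v u :=
    fun u v => (hτ.isSymmSndFDerivAt (by simpa using! (by decide : (2 : WithTop ℕ∞) ≤ ∞))).eq u v
  rw [← transition_self] at hX₀
  have h1 := eventually_coordField_eq X hq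
  have h2 := fderiv_pushforward hτ hX₀
    (((smoothFieldAt_iff _ _ _).1 hX).differentiableAt (by simp)) h1 (fiberVec q)
  have h3 := h1.self_of_nhds
  rw [fderiv_transition_apply hq, transition_self] at h3
  rw [fderiv_transition_apply hq, fderiv_transition_apply hq, transition_self] at h2
  rw [coordCompleteLift, extChartAt_tangent_eq hq, h2, h3, hs]

variable [RiemannianBundle (fun x : M => TangentSpace 𝓘(ℝ, E) x)]

theorem mirrorAdjoint_eq (q : TangentBundle 𝓘(ℝ, E) M) (ζ : E × E) :
    mirrorAdjoint q ζ = (ζ.2 + christoffelMap q.proj ζ.1 (fiberVec q),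
      -christoffelMap q.proj (ζ.2 + christoffelMap q.proj ζ.1 (fiberVec q)) (fiberVec q)) := by
  have h : connMap q ζ = ζ.2 + christoffelMap q.proj ζ.1 (fiberVec q) := add_comm _ _
  rw [← h]
  rfl

/-- The connection map is tensorial: the term `D²τ` in the law for `Γ` is the one in the fibre
component of the transformed vector. For the horizontal lift the same two terms occur with opposite
signs and cancel. -/
theorem tangentCoordChange_mirrorAdjoint {Γ : E → E →L[ℝ] E →L[ℝ] E}
    {p₀ q : TangentBundle 𝓘(ℝ, E) M} (hq : q.proj ∈ (extChartAt 𝓘(ℝ, E) p₀.proj).source)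
    (h : ∀ a b, transitionEquiv hq (christoffelMap q.proj a b) =
      Γ (extChartAt 𝓘(ℝ, E) p₀.proj q.proj) (transitionEquiv hq a) (transitionEquiv hq b) +
      fderiv ℝ (fderiv ℝ (transition p₀.proj q.proj)) (extChartAt 𝓘(ℝ, E) q.proj q.proj) a b)
    (ζ : E × E) :
    tangentCoordChange 𝓘(ℝ, E).tangent q p₀ q (mirrorAdjoint q ζ) =
      coordMirrorAdjoint Γ (extChartAt 𝓘(ℝ, E).tangent p₀ q)
        (tangentCoordChange 𝓘(ℝ, E).tangent q p₀ q ζ) := by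
  rw [mirrorAdjoint_eq]
  refine (tangentCoordChange_tangent_apply hq _ _).trans ?_
  rw [tangentCoordChange_tangent_apply hq ζ.1 ζ.2, coordMirrorAdjoint, extChartAt_tangent_eq hq]
  have h1 : transitionEquiv hq (ζ.2 + christoffelMap q.proj ζ.1 (fiberVec q)) =
      fderiv ℝ (fderiv ℝ (transition p₀.proj q.proj)) (extChartAt 𝓘(ℝ, E) q.proj q.proj) ζ.1
        (fiberVec q) + transitionEquiv hq ζ.2 +
      Γ (extChartAt 𝓘(ℝ, E) p₀.proj q.proj) (transitionEquiv hq ζ.1)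
        (transitionEquiv hq (fiberVec q)) := by
    rw [map_add, h]
    abel
  refine Prod.ext h1 ?_
  simp only [← h1, map_neg, h]
  abel

/-! ### Local expressions of the fields -/

omit [FiniteDimensional ℝ E] [RiemannianBundle (fun x : M => TangentSpace 𝓘(ℝ, E) x)] in
theorem coordField_mirror (p : TangentBundle 𝓘(ℝ, E) M)
    (Y : ∀ q : TangentBundle 𝓘(ℝ, E) M, TangentSpace 𝓘(ℝ, E).tangent q) :
    coordField 𝓘(ℝ, E).tangent p (fun q => mirror q (Y q))
      =ᶠ[𝓝 (extChartAt 𝓘(ℝ, E).tangent p p)]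
        fun z => (0, (coordField 𝓘(ℝ, E).tangent p Y z).1) := by
  filter_upwards [eventually_extChartAt_tangent p] with z hz
  exact tangentCoordChange_mirror hz.2 (Y _)

omit [FiniteDimensional ℝ E] [RiemannianBundle (fun x : M => TangentSpace 𝓘(ℝ, E) x)] in
theorem coordField_canonicalField (p : TangentBundle 𝓘(ℝ, E) M) :
    coordField 𝓘(ℝ, E).tangent p canonicalField
      =ᶠ[𝓝 (extChartAt 𝓘(ℝ, E).tangent p p)] fun z => (0, z.2) := by
  filter_upwards [eventually_extChartAt_tangent p] with z hz
  refine (tangentCoordChange_canonicalField hz.2).trans ?_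
  rw [← hz.1]

omit [FiniteDimensional ℝ E] [RiemannianBundle (fun x : M => TangentSpace 𝓘(ℝ, E) x)] in
theorem coordField_completeLift {X : ∀ x : M, TangentSpace 𝓘(ℝ, E) x}
    (hX : ∀ x, SmoothFieldAt 𝓘(ℝ, E) X x) (p : TangentBundle 𝓘(ℝ, E) M) :
    coordField 𝓘(ℝ, E).tangent p (completeLift X)
      =ᶠ[𝓝 (extChartAt 𝓘(ℝ, E).tangent p p)]
        coordCompleteLift (coordField 𝓘(ℝ, E) p.proj X) := by
  filter_upwards [eventually_extChartAt_tangent p, eventually_proj_extChartAt_symm p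
    (eventually_differentiableAt_coordField (hX p.proj))] with z hz hd
  refine (tangentCoordChange_completeLift (hX _) hd hz.2).trans ?_
  rw [← hz.1]

omit [FiniteDimensional ℝ E] in
-- Only base components enter, and these change by `Dτ` without second-order terms.
theorem coordField_horVol (o : ManifoldOrientation n E M)
    (e : Module.Basis (Fin (n + 1)) ℝ E)
    (p : TangentBundle 𝓘(ℝ, E) M)
    (Y : Fin (n + 1) → ∀ q : TangentBundle 𝓘(ℝ, E) M, TangentSpace 𝓘(ℝ, E).tangent q) :
    (fun q => horVol o q fun j => Y j q) ∘ (extChartAt 𝓘(ℝ, E).tangent p).symm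
      =ᶠ[𝓝 (extChartAt 𝓘(ℝ, E).tangent p p)] fun z => volCoeff o p.proj e z.1 *
        e.det fun j => (coordField 𝓘(ℝ, E).tangent p (Y j) z).1 := by
  filter_upwards [eventually_extChartAt_tangent p] with z hz
  set q := (extChartAt 𝓘(ℝ, E).tangent p).symm z with hq
  have h1 := volMap_eq o e hz.2 fun j => (show E × E from Y j q).1
  have h2 : extChartAt 𝓘(ℝ, E) p.proj q.proj = z.1 := congrArg Prod.fst hz.1.symm
  rw [h2] at h1
  refine Eq.trans ?_ (h1.trans ?_)
  · rfl
  · congr 2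
    funext j
    exact (congrArg Prod.fst (tangentCoordChange_tangent_apply hz.2 _ _)).symm

variable [IsContMDiffRiemannianBundle 𝓘(ℝ, E) ∞ E (fun x : M => TangentSpace 𝓘(ℝ, E) x)]

theorem coordField_mirrorAdjoint (p : TangentBundle 𝓘(ℝ, E) M)
    (Y : ∀ q : TangentBundle 𝓘(ℝ, E) M, TangentSpace 𝓘(ℝ, E).tangent q) :
    coordField 𝓘(ℝ, E).tangent p (fun q => mirrorAdjoint q (Y q))
      =ᶠ[𝓝 (extChartAt 𝓘(ℝ, E).tangent p p)]
        fun z => coordMirrorAdjoint (christoffelSecond (metricInChart p.proj)) z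
          (coordField 𝓘(ℝ, E).tangent p Y z) := by
  filter_upwards [eventually_extChartAt_tangent p, eventually_proj_extChartAt_symm p
    (eventually_christoffel_transition (E := E) p.proj)] with z hz hΓ
  obtain ⟨hq, h⟩ := hΓ
  refine (tangentCoordChange_mirrorAdjoint hq h (Y _)).trans ?_
  rw [← hz.1]
  rfl

theorem mirrorAdjoint_self (p : TangentBundle 𝓘(ℝ, E) M) (ζ : E × E) :
    mirrorAdjoint p ζ = coordMirrorAdjoint (christoffelSecond (metricInChart p.proj))
      (extChartAt 𝓘(ℝ, E).tangent p p) ζ := by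
  obtain ⟨hq, h⟩ := (eventually_christoffel_transition (E := E) p.proj).self_of_nhds
  have h1 := tangentCoordChange_mirrorAdjoint hq h ζ
  have hid : ∀ w : E × E, tangentCoordChange 𝓘(ℝ, E).tangent p p p w = w := fun w =>
    tangentCoordChange_self (I := 𝓘(ℝ, E).tangent) (mem_extChartAt_source p)
  rw [hid] at h1
  exact (hid _).symm.trans h1

end TangentFields

theorem fderiv_sum_const_mul {E ι : Type*} [NormedAddCommGroup E] [NormedSpace ℝ E] [Fintype ι]
    {f : ι → E → ℝ} {x w : E} (c : ι → ℝ) (hf : ∀ i, DifferentiableAt ℝ (f i) x) :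
    fderiv ℝ (fun z => ∑ i, c i * f i z) x w = ∑ i, c i * fderiv ℝ (f i) x w := by
  rw [(HasFDerivAt.fun_sum (u := Finset.univ)
    fun i _ => (hf i).hasFDerivAt.const_mul (c i)).fderiv]
  simp

/-! ## Calculus with invariant forms and endomorphisms -/

section InvariantForms

variable {E : Type*} [NormedAddCommGroup E] [NormedSpace ℝ E]
  {H : Type*} [TopologicalSpace H] {I : ModelWithCorners ℝ E H}
  {N : Type*} [TopologicalSpace N] [ChartedSpace H N] [IsManifold I 1 N]
  {X : ∀ q : N, TangentSpace I q}

theorem smoothEndo_id : SmoothEndo I fun q : N => (LinearMap.id : TangentSpace I q →ₗ[ℝ] _) :=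
  fun _ _ h => h

theorem lieEndoVanishes_id :
    LieEndoVanishes I X fun q : N => (LinearMap.id : TangentSpace I q →ₗ[ℝ] _) :=
  fun _ _ _ => sub_self _

theorem LieEndoVanishes.mlieBracket_eq {A : ∀ q : N, TangentSpace I q →ₗ[ℝ] TangentSpace I q}
    (hA : LieEndoVanishes I X A) {p : N} {Y : ∀ q : N, TangentSpace I q}
    (hY : SmoothFieldAt I Y p) :
    VectorField.mlieBracket I X (fun q => A q (Y q)) p = A p (VectorField.mlieBracket I X Y p) :=
  sub_eq_zero.1 (hA p Y hY)

theorem LieFormVanishes.mvfderiv_eq {k : ℕ} {η : ∀ q : N, TangentSpace I q [⋀^Fin k]→ₗ[ℝ] ℝ}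
    (hη : LieFormVanishes I X η) {p : N} {Y : Fin k → ∀ q : N, TangentSpace I q}
    (hY : ∀ j, SmoothFieldAt I (Y j) p) :
    mvfderiv I (fun q => η q fun j => Y j q) p (X p) =
      ∑ j, η p (Function.update (fun l => Y l p) j (VectorField.mlieBracket I X (Y j) p)) :=
  sub_eq_zero.1 (hη p Y hY)

theorem SmoothForm.compLinearMap {k : ℕ} {η : ∀ q : N, TangentSpace I q [⋀^Fin k]→ₗ[ℝ] ℝ}
    {A : ∀ q : N, TangentSpace I q →ₗ[ℝ] TangentSpace I q} (hη : SmoothForm I η)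
    (hA : SmoothEndo I A) : SmoothForm I fun q => (η q).compLinearMap (A q) :=
  fun p Y hY => hη p (fun j q => A q (Y j q)) fun j => hA p (Y j) (hY j)

/-- Invariance of `A` moves it out of the bracket, `[X, A Y] = A [X, Y]`, so the Leibniz terms of
`η` on the fields `A Y` are those of the composed form on `Y`. -/
theorem LieFormVanishes.compLinearMap {k : ℕ} {η : ∀ q : N, TangentSpace I q [⋀^Fin k]→ₗ[ℝ] ℝ}
    {A : ∀ q : N, TangentSpace I q →ₗ[ℝ] TangentSpace I q} (hη : LieFormVanishes I X η)
    (hA : SmoothEndo I A) (hXA : LieEndoVanishes I X A) :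
    LieFormVanishes I X fun q => (η q).compLinearMap (A q) := by
  intro p Y hY
  refine sub_eq_zero.2 ((hη.mvfderiv_eq (Y := fun j q => A q (Y j q))
    fun j => hA p (Y j) (hY j)).trans ?_)
  refine Finset.sum_congr rfl fun j _ => ?_
  rw [hXA.mlieBracket_eq (hY j), AlternatingMap.compLinearMap_apply]
  congr 1
  exact (Function.comp_update (A p) _ j _).symm

theorem SmoothForm.curryLeft {k : ℕ} {η : ∀ q : N, TangentSpace I q [⋀^Fin (k + 1)]→ₗ[ℝ] ℝ}
    {ξ : ∀ q : N, TangentSpace I q} (hη : SmoothForm I η) (hξ : ∀ p, SmoothFieldAt I ξ p) :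
    SmoothForm I fun q => (η q).curryLeft (ξ q) := by
  intro p Y hY
  have h := hη p (Fin.cons ξ Y) (Fin.cases (hξ p) hY)
  refine h.congr_of_eventuallyEq (.of_forall fun q => congrArg (η q) ?_)
  funext j
  cases j using Fin.cases <;> rfl

theorem LieFormVanishes.curryLeft {k : ℕ}
    {η : ∀ q : N, TangentSpace I q [⋀^Fin (k + 1)]→ₗ[ℝ] ℝ}
    {ξ : ∀ q : N, TangentSpace I q} (hη : LieFormVanishes I X η)
    (hξ : ∀ p, SmoothFieldAt I ξ p) (hXξ : ∀ p, VectorField.mlieBracket I X ξ p = 0) :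
    LieFormVanishes I X fun q => (η q).curryLeft (ξ q) := by
  intro p Y hY
  have hc : ∀ q, (fun j => (Fin.cons ξ Y : Fin (k + 1) → ∀ q : N, TangentSpace I q) j q) =
      Matrix.vecCons (ξ q) fun j => Y j q := fun q => by
    funext j
    cases j using Fin.cases <;> rfl
  have h := hη.mvfderiv_eq (Y := Fin.cons ξ Y) (p := p) (Fin.cases (hξ p) hY)
  rw [Fin.sum_univ_succ] at h
  simp only [hc, Fin.cons_zero, Fin.cons_succ, hXξ] at h
  -- The Leibniz term of the slot occupied by `ξ` contains `[X, ξ] = 0`.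
  rw [(η p).map_coord_zero 0 (by simp), zero_add] at h
  refine sub_eq_zero.2 (h.trans (Finset.sum_congr rfl fun j _ => ?_))
  exact congrArg (η p) (Fin.cons_update (α := fun _ => TangentSpace I p) _ _ _ _).symm

variable [I.Boundaryless]

omit [I.Boundaryless] in
theorem SmoothForm.const_smul {k : ℕ} {η : ∀ q : N, TangentSpace I q [⋀^Fin k]→ₗ[ℝ] ℝ}
    (hη : SmoothForm I η) (c : ℝ) : SmoothForm I fun q => c • η q :=
  fun p Y hY => contMDiffAt_const.mul (hη p Y hY)

theorem LieFormVanishes.const_smul {k : ℕ} {η : ∀ q : N, TangentSpace I q [⋀^Fin k]→ₗ[ℝ] ℝ}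
    (hη : LieFormVanishes I X η) (hs : SmoothForm I η) (c : ℝ) :
    LieFormVanishes I X fun q => c • η q := by
  intro p Y hY
  have h1 := hη.mvfderiv_eq hY
  have h2 := hs p Y hY
  have h3 := hs.const_smul c p Y hY
  rw [mvfderiv_eq_fderiv I h2] at h1
  refine sub_eq_zero.2 ((mvfderiv_eq_fderiv I h3 _).trans ?_)
  have h4 := (((contMDiffAt_iff_contDiffAt_symm I _ p).1 h2).differentiableAt
    (by simp)).hasFDerivAt.const_mul c
  refine (DFunLike.congr_fun h4.fderiv _).trans ?_
  refine (congrArg (c * ·) h1).trans ?_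
  simp only [AlternatingMap.smul_apply, smul_eq_mul, Finset.mul_sum]

omit [I.Boundaryless] in
theorem SmoothForm.altComp {k : ℕ} {η : ∀ q : N, TangentSpace I q [⋀^Fin k]→ₗ[ℝ] ℝ}
    {A : Fin k → ∀ q : N, TangentSpace I q →ₗ[ℝ] TangentSpace I q} (hη : SmoothForm I η)
    (hA : ∀ j, SmoothEndo I (A j)) :
    SmoothForm I fun q => altComp (η q) fun j => A j q := by
  intro p Y hY
  simp only [altComp_apply, Units.smul_def, zsmul_eq_mul]
  refine contMDiffAt_finsetSum fun σ _ => contMDiffAt_const.mul ?_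
  exact hη p (fun j q => A j q (Y (σ j) q)) fun j => hA j p _ (hY _)

theorem LieFormVanishes.altComp {k : ℕ} {η : ∀ q : N, TangentSpace I q [⋀^Fin k]→ₗ[ℝ] ℝ}
    {A : Fin k → ∀ q : N, TangentSpace I q →ₗ[ℝ] TangentSpace I q} (hη : LieFormVanishes I X η)
    (hs : SmoothForm I η) (hA : ∀ j, SmoothEndo I (A j)) (hXA : ∀ j, LieEndoVanishes I X (A j)) :
    LieFormVanishes I X fun q => altComp (η q) fun j => A j q := by
  intro p Y hY
  have hZ : ∀ (σ : Equiv.Perm (Fin k)) j, SmoothFieldAt I (fun q => A j q (Y (σ j) q)) p :=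
    fun σ j => hA j p _ (hY _)
  have h2 := fderiv_sum_const_mul (E := E) (w := X p)
    (fun σ : Equiv.Perm (Fin k) => ((Equiv.Perm.sign σ : ℤ) : ℝ)) fun σ =>
      ((contMDiffAt_iff_contDiffAt_symm I _ p).1 (hs p _ (hZ σ))).differentiableAt (by simp)
  have h3 : (fun q => TangentLift.altComp (η q) (fun j => A j q) fun j => Y j q) ∘
      (extChartAt I p).symm = fun z => ∑ σ : Equiv.Perm (Fin k),
        ((Equiv.Perm.sign σ : ℤ) : ℝ) *
        ((fun q => η q fun j => A j q (Y (σ j) q)) ∘ (extChartAt I p).symm) z := by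
    funext z
    simp only [Function.comp_apply, altComp_apply, Units.smul_def, zsmul_eq_mul]
  rw [← h3] at h2
  refine sub_eq_zero.2 ((mvfderiv_eq_fderiv I (hs.altComp hA p Y hY) _).trans ?_)
  refine h2.trans ?_
  simp only [altComp_apply, Units.smul_def, zsmul_eq_mul]
  rw [Finset.sum_comm]
  refine Finset.sum_congr rfl fun σ _ => ?_
  rw [← Finset.mul_sum]
  refine congrArg _ ?_
  refine (mvfderiv_eq_fderiv I (hs p _ (hZ σ)) _).symm.trans ?_
  -- In the summand of `σ`, slot `j` holds `Y (σ j)`. Reindexing by `σ` turns the sum over slots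
  -- into the sum over the fields `Y`.
  refine (hη.mvfderiv_eq (hZ σ)).trans (Fintype.sum_equiv σ _ _ fun j => congrArg (η p) ?_)
  rw [(hXA j).mlieBracket_eq (hY _)]
  funext l
  by_cases h : l = j
  · subst h
    simp
  · rw [Function.update_of_ne h, Function.update_of_ne (σ.injective.ne h)]

end InvariantForms

/-! ## Invariance under the complete lift of a Killing field -/

section Invariance

variable {n : ℕ} {E : Type*} [NormedAddCommGroup E] [NormedSpace ℝ E] [FiniteDimensional ℝ E]
  [Fact (Module.finrank ℝ E = n + 1)]
  {M : Type*} [TopologicalSpace M] [ChartedSpace E M] [IsManifold 𝓘(ℝ, E) ∞ M]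

omit [FiniteDimensional ℝ E] in
theorem smoothFieldAt_completeLift {X : ∀ x : M, TangentSpace 𝓘(ℝ, E) x}
    (hX : ∀ x, SmoothFieldAt 𝓘(ℝ, E) X x) (p : TangentBundle 𝓘(ℝ, E) M) :
    SmoothFieldAt 𝓘(ℝ, E).tangent (completeLift X) p :=
  (smoothFieldAt_iff _ _ _).2 <| ContDiffAt.congr_of_eventuallyEq
    (contDiffAt_coordCompleteLift (z := extChartAt 𝓘(ℝ, E).tangent p p)
      ((smoothFieldAt_iff _ _ _).1 (hX p.proj)))
    (coordField_completeLift hX p)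

omit [FiniteDimensional ℝ E] in
theorem completeLift_self {X : ∀ x : M, TangentSpace 𝓘(ℝ, E) x}
    (hX : ∀ x, SmoothFieldAt 𝓘(ℝ, E) X x) (p : TangentBundle 𝓘(ℝ, E) M) :
    completeLift X p = coordCompleteLift (coordField 𝓘(ℝ, E) p.proj X)
      (extChartAt 𝓘(ℝ, E).tangent p p) :=
  (coordField_self 𝓘(ℝ, E).tangent p (completeLift X)).symm.trans
    (coordField_completeLift hX p).self_of_nhds

omit [FiniteDimensional ℝ E] in
theorem smoothFieldAt_canonicalField (p : TangentBundle 𝓘(ℝ, E) M) :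
    SmoothFieldAt 𝓘(ℝ, E).tangent canonicalField p :=
  (smoothFieldAt_iff _ _ _).2 <| ContDiffAt.congr_of_eventuallyEq
    (contDiffAt_const.prodMk contDiffAt_snd) (coordField_canonicalField p)

omit [FiniteDimensional ℝ E] in
theorem smoothEndo_mirror :
    SmoothEndo (N := TangentBundle 𝓘(ℝ, E) M) 𝓘(ℝ, E).tangent mirror := fun p Y hY =>
  (smoothFieldAt_iff _ _ _).2 <| ContDiffAt.congr_of_eventuallyEq
    (contDiffAt_const.prodMk ((smoothFieldAt_iff _ _ _).1 hY).fst) (coordField_mirror p Y)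

omit [FiniteDimensional ℝ E] in
theorem mlieBracket_completeLift {X : ∀ x : M, TangentSpace 𝓘(ℝ, E) x}
    (hX : ∀ x, SmoothFieldAt 𝓘(ℝ, E) X x) {p : TangentBundle 𝓘(ℝ, E) M}
    {Y : ∀ q : TangentBundle 𝓘(ℝ, E) M, TangentSpace 𝓘(ℝ, E).tangent q} {Z : E × E → E × E}
    (hZ : coordField 𝓘(ℝ, E).tangent p Y =ᶠ[𝓝 (extChartAt 𝓘(ℝ, E).tangent p p)] Z) :
    VectorField.mlieBracket 𝓘(ℝ, E).tangent (completeLift X) Y p =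
      VectorField.lieBracket ℝ (coordCompleteLift (coordField 𝓘(ℝ, E) p.proj X)) Z
        (extChartAt 𝓘(ℝ, E).tangent p p) :=
  (mlieBracket_eq_lieBracket_coordField _ _ _ _).trans
    ((coordField_completeLift hX p).lieBracket_vectorField_eq hZ)

omit [FiniteDimensional ℝ E] in
theorem mlieBracket_completeLift_canonicalField {X : ∀ x : M, TangentSpace 𝓘(ℝ, E) x}
    (hX : ∀ x, SmoothFieldAt 𝓘(ℝ, E) X x) (p : TangentBundle 𝓘(ℝ, E) M) :
    VectorField.mlieBracket 𝓘(ℝ, E).tangent (completeLift X) canonicalField p = 0 :=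
  (mlieBracket_completeLift hX (coordField_canonicalField p)).trans
    (lieBracket_coordCanonical (z := extChartAt 𝓘(ℝ, E).tangent p p)
      ((smoothFieldAt_iff _ _ _).1 (hX p.proj)))

omit [FiniteDimensional ℝ E] in
theorem lieEndoVanishes_mirror {X : ∀ x : M, TangentSpace 𝓘(ℝ, E) x}
    (hX : ∀ x, SmoothFieldAt 𝓘(ℝ, E) X x) :
    LieEndoVanishes 𝓘(ℝ, E).tangent (completeLift X) mirror := by
  intro p Y hY
  have hX' := (smoothFieldAt_iff _ _ _).1 (hX p.proj)
  have hY' := ((smoothFieldAt_iff _ _ _).1 hY).differentiableAt (by simp)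
  refine sub_eq_zero.2 ((mlieBracket_completeLift hX (coordField_mirror p Y)).trans ?_)
  refine (lieBracket_coordMirror (z := extChartAt 𝓘(ℝ, E).tangent p p) hX' hY').trans ?_
  exact (congrArg (fun w : E × E => mirror p w)
    (mlieBracket_completeLift hX (p := p) (Y := Y) (.refl _ _))).symm

variable [RiemannianBundle (fun x : M => TangentSpace 𝓘(ℝ, E) x)]
  [IsContMDiffRiemannianBundle 𝓘(ℝ, E) ∞ E (fun x : M => TangentSpace 𝓘(ℝ, E) x)]

theorem contDiffAt_christoffelSecond_metricInChart (x : M) :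
    ContDiffAt ℝ ∞ (christoffelSecond (metricInChart x)) (extChartAt 𝓘(ℝ, E) x x) :=
  have : CompleteSpace E := FiniteDimensional.complete ℝ E
  contDiffAt_christoffelSecond (contDiffAt_metricInChart x)
    (metricInChart_isInvertible (mem_extChartAt_target x))

theorem smoothEndo_mirrorAdjoint :
    SmoothEndo (N := TangentBundle 𝓘(ℝ, E) M) 𝓘(ℝ, E).tangent mirrorAdjoint := fun p Y hY =>
  (smoothFieldAt_iff _ _ _).2 <| ContDiffAt.congr_of_eventuallyEq
    (contDiffAt_coordMirrorAdjoint (z := extChartAt 𝓘(ℝ, E).tangent p p)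
      (contDiffAt_christoffelSecond_metricInChart p.proj) ((smoothFieldAt_iff _ _ _).1 hY))
    (coordField_mirrorAdjoint p Y)

theorem IsKilling.lieEndoVanishes_mirrorAdjoint {X : ∀ x : M, TangentSpace 𝓘(ℝ, E) x}
    (hX : IsKilling X) : LieEndoVanishes 𝓘(ℝ, E).tangent (completeLift X) mirrorAdjoint := by
  intro p Y hY
  have : CompleteSpace E := FiniteDimensional.complete ℝ E
  have hX' := (smoothFieldAt_iff _ _ _).1 (hX.1 p.proj)
  have hY' := ((smoothFieldAt_iff _ _ _).1 hY).differentiableAt (by simp)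
  have hΓ := fderiv_christoffelSecond_of_killing (contDiffAt_metricInChart p.proj)
    (metricInChart_isInvertible (mem_extChartAt_target p.proj)) hX'
    (.of_forall fun y a b => metricInChart_symm p.proj y a b) (hX.eventually_killingForm p.proj)
  refine sub_eq_zero.2 ((mlieBracket_completeLift hX.1 (coordField_mirrorAdjoint p Y)).trans ?_)
  refine (lieBracket_coordMirrorAdjoint (z := extChartAt 𝓘(ℝ, E).tangent p p)
    ((contDiffAt_christoffelSecond_metricInChart p.proj).differentiableAt (by simp))
    hX' hY' hΓ).trans ?_
  refine (mirrorAdjoint_self p _).symm.trans ?_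
  exact (congrArg (fun w : E × E => mirrorAdjoint p w)
    (mlieBracket_completeLift hX.1 (p := p) (Y := Y) (.refl _ _))).symm

theorem smoothForm_horVol (o : ManifoldOrientation n E M) :
    SmoothForm 𝓘(ℝ, E).tangent (horVol o) := by
  intro p Y hY
  let e := Module.finBasisOfFinrankEq ℝ E (Fact.out : Module.finrank ℝ E = n + 1)
  refine (contMDiffAt_iff_contDiffAt_symm _ _ _).2 ?_
  refine ContDiffAt.congr_of_eventuallyEq ?_ (coordField_horVol o e p Y)
  have hc : ContDiffAt ℝ ∞ (fun z : E × E => volCoeff o p.proj e z.1)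
      (extChartAt 𝓘(ℝ, E).tangent p p) :=
    ContDiffAt.comp (g := volCoeff o p.proj e) (extChartAt 𝓘(ℝ, E).tangent p p)
      (contDiffAt_volCoeff o e p.proj) contDiffAt_fst
  exact hc.mul (contDiffAt_basis_det e fun j => ((smoothFieldAt_iff _ _ _).1 (hY j)).fst)

omit [FiniteDimensional ℝ E]
  [IsContMDiffRiemannianBundle 𝓘(ℝ, E) ∞ E (fun x : M => TangentSpace 𝓘(ℝ, E) x)] in
theorem horVol_self (o : ManifoldOrientation n E M) (e : Module.Basis (Fin (n + 1)) ℝ E)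
    (p : TangentBundle 𝓘(ℝ, E) M) (W : Fin (n + 1) → E × E) :
    horVol o p W = volCoeff o p.proj e (extChartAt 𝓘(ℝ, E) p.proj p.proj) *
      e.det fun j => (W j).1 := by
  refine (volMap_eq o e (mem_extChartAt_source p.proj) fun j => (W j).1).trans ?_
  refine congrArg (_ * ·) (congrArg e.det (funext fun j => ?_))
  exact tangentCoordChange_self (mem_extChartAt_source p.proj)

theorem IsKilling.lieFormVanishes_horVol (o : ManifoldOrientation n E M)
    {X : ∀ x : M, TangentSpace 𝓘(ℝ, E) x} (hX : IsKilling X) :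
    LieFormVanishes 𝓘(ℝ, E).tangent (completeLift X) (horVol o) := by
  intro p Y hY
  let e := Module.finBasisOfFinrankEq ℝ E (Fact.out : Module.finrank ℝ E = n + 1)
  have hX' := (smoothFieldAt_iff _ _ _).1 (hX.1 p.proj)
  have hY' := fun j => ((smoothFieldAt_iff _ _ _).1 (hY j)).differentiableAt (by simp)
  refine sub_eq_zero.2 ((mvfderiv_eq_fderiv _ (smoothForm_horVol o p Y hY) _).trans ?_)
  rw [(coordField_horVol o e p Y).fderiv_eq, completeLift_self hX.1]
  refine (fderiv_coordVolume (z := extChartAt 𝓘(ℝ, E).tangent p p) e hX'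
    ((contDiffAt_volCoeff o e p.proj).differentiableAt (by simp)) hY'
    (fderiv_volCoeff o e hX p.proj)).trans ?_
  refine Finset.sum_congr rfl fun j _ => ?_
  refine Eq.trans ?_ (horVol_self o e p _).symm
  refine congrArg (_ * ·) (congrArg e.det (funext fun l => ?_))
  have hbr : @Eq (E × E) (VectorField.mlieBracket 𝓘(ℝ, E).tangent (completeLift X) (Y j) p) _ :=
    mlieBracket_completeLift hX.1 (p := p) (Y := Y j) (.refl _ _)
  by_cases h : l = j
  · subst h
    rw [Function.update_self, Function.update_self]
    exact congrArg Prod.fst hbr.symm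
  · rw [Function.update_of_ne h, Function.update_of_ne h]
    exact congrArg Prod.fst (coordField_self 𝓘(ℝ, E).tangent p (Y l))

omit [IsContMDiffRiemannianBundle 𝓘(ℝ, E) ∞ E (fun x : M => TangentSpace 𝓘(ℝ, E) x)] in
-- The base component of `Bᵗ` is the connection map. Smoothness and invariance of the vertical
-- volume thus follow from those of `π^* vol` and of `Bᵗ`.
theorem vertVol_eq (o : ManifoldOrientation n E M) :
    vertVol o = fun p => (horVol o p).compLinearMap (mirrorAdjoint p) := rfl

theorem smoothForm_vertVol (o : ManifoldOrientation n E M) :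
    SmoothForm 𝓘(ℝ, E).tangent (vertVol o) :=
  vertVol_eq o ▸ (smoothForm_horVol o).compLinearMap smoothEndo_mirrorAdjoint

theorem IsKilling.lieFormVanishes_vertVol (o : ManifoldOrientation n E M)
    {X : ∀ x : M, TangentSpace 𝓘(ℝ, E) x} (hX : IsKilling X) :
    LieFormVanishes 𝓘(ℝ, E).tangent (completeLift X) (vertVol o) :=
  vertVol_eq o ▸ (hX.lieFormVanishes_horVol o).compLinearMap smoothEndo_mirrorAdjoint
    hX.lieEndoVanishes_mirrorAdjoint

theorem IsKilling.mlieBracket_completeLift_geodesicField {X : ∀ x : M, TangentSpace 𝓘(ℝ, E) x}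
    (hX : IsKilling X) (p : TangentBundle 𝓘(ℝ, E) M) :
    VectorField.mlieBracket 𝓘(ℝ, E).tangent (completeLift X) geodesicField p = 0 := by
  refine (hX.lieEndoVanishes_mirrorAdjoint.mlieBracket_eq
    (smoothFieldAt_canonicalField p)).trans ?_
  rw [mlieBracket_completeLift_canonicalField hX.1, map_zero]

theorem smoothForm_alphaTop (o : ManifoldOrientation n E M) :
    SmoothForm 𝓘(ℝ, E).tangent (alphaTop o) :=
  (smoothForm_vertVol o).curryLeft smoothFieldAt_canonicalField

theorem IsKilling.lieFormVanishes_alphaTop (o : ManifoldOrientation n E M)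
    {X : ∀ x : M, TangentSpace 𝓘(ℝ, E) x} (hX : IsKilling X) :
    LieFormVanishes 𝓘(ℝ, E).tangent (completeLift X) (alphaTop o) :=
  (hX.lieFormVanishes_vertVol o).curryLeft smoothFieldAt_canonicalField
    (mlieBracket_completeLift_canonicalField hX.1)

/-- The endomorphism `B` or `1` in the definition of `alpha`. -/
def mirrorOrId (c : Prop) [Decidable c] (p : TangentBundle 𝓘(ℝ, E) M) :
    TangentSpace 𝓘(ℝ, E).tangent p →ₗ[ℝ] TangentSpace 𝓘(ℝ, E).tangent p :=
  if c then mirror p else LinearMap.id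

omit [FiniteDimensional ℝ E] [RiemannianBundle (fun x : M => TangentSpace 𝓘(ℝ, E) x)]
  [IsContMDiffRiemannianBundle 𝓘(ℝ, E) ∞ E (fun x : M => TangentSpace 𝓘(ℝ, E) x)] in
theorem smoothEndo_mirrorOrId (c : Prop) [Decidable c] :
    SmoothEndo (N := TangentBundle 𝓘(ℝ, E) M) 𝓘(ℝ, E).tangent (mirrorOrId c) := by
  by_cases hc : c
  · simpa only [SmoothEndo, mirrorOrId, if_pos hc] using smoothEndo_mirror
  · simpa only [SmoothEndo, mirrorOrId, if_neg hc] using smoothEndo_id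

omit [FiniteDimensional ℝ E] [RiemannianBundle (fun x : M => TangentSpace 𝓘(ℝ, E) x)]
  [IsContMDiffRiemannianBundle 𝓘(ℝ, E) ∞ E (fun x : M => TangentSpace 𝓘(ℝ, E) x)] in
theorem lieEndoVanishes_mirrorOrId (c : Prop) [Decidable c]
    {X : ∀ x : M, TangentSpace 𝓘(ℝ, E) x} (hX : ∀ x, SmoothFieldAt 𝓘(ℝ, E) X x) :
    LieEndoVanishes 𝓘(ℝ, E).tangent (completeLift X) (mirrorOrId c) := by
  by_cases hc : c
  · simpa only [LieEndoVanishes, lieDerivEndo, mirrorOrId, if_pos hc] using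
      lieEndoVanishes_mirror hX
  · simpa only [LieEndoVanishes, lieDerivEndo, mirrorOrId, if_neg hc] using
      lieEndoVanishes_id

theorem smoothForm_alpha (o : ManifoldOrientation n E M) (i : ℕ) :
    SmoothForm 𝓘(ℝ, E).tangent (alpha o i) :=
  ((smoothForm_alphaTop o).altComp (A := fun j => mirrorOrId ((j : ℕ) < n - i))
    fun _ => smoothEndo_mirrorOrId _).const_smul _

theorem IsKilling.lieFormVanishes_alpha (o : ManifoldOrientation n E M)
    {X : ∀ x : M, TangentSpace 𝓘(ℝ, E) x} (hX : IsKilling X) (i : ℕ) :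
    LieFormVanishes 𝓘(ℝ, E).tangent (completeLift X) (alpha o i) :=
  ((hX.lieFormVanishes_alphaTop o).altComp (A := fun j => mirrorOrId ((j : ℕ) < n - i))
    (smoothForm_alphaTop o) (fun _ => smoothEndo_mirrorOrId _)
    fun _ => lieEndoVanishes_mirrorOrId _ hX.1).const_smul
    ((smoothForm_alphaTop o).altComp fun _ => smoothEndo_mirrorOrId _) _

/-! ### The sphere bundles -/

omit [FiniteDimensional ℝ E]
  [IsContMDiffRiemannianBundle 𝓘(ℝ, E) ∞ E (fun x : M => TangentSpace 𝓘(ℝ, E) x)] in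
theorem normSq_extChartAt_symm (p : TangentBundle 𝓘(ℝ, E) M) :
    normSq ∘ (extChartAt 𝓘(ℝ, E).tangent p).symm
      =ᶠ[𝓝 (extChartAt 𝓘(ℝ, E).tangent p p)] fun z => metricInChart p.proj z.1 z.2 z.2 := by
  filter_upwards [eventually_extChartAt_tangent p] with z hz
  have h := metricInChart_transition hz.2
    (fiberVec ((extChartAt 𝓘(ℝ, E).tangent p).symm z))
    (fiberVec ((extChartAt 𝓘(ℝ, E).tangent p).symm z))
  have h1 := hz.1.trans (extChartAt_tangent_eq hz.2)
  have h2 : z.1 = extChartAt 𝓘(ℝ, E) p.proj _ := congrArg Prod.fst h1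
  have h3 : z.2 = transitionEquiv hz.2 _ := congrArg Prod.snd h1
  rw [h2, h3]
  exact h.symm

theorem IsKilling.tangentToSphere_completeLift {X : ∀ x : M, TangentSpace 𝓘(ℝ, E) x}
    (hX : IsKilling X) (p : TangentBundle 𝓘(ℝ, E) M) : TangentToSphere p (completeLift X p) := by
  have hg : ContDiffAt ℝ ∞ (fun z : E × E => metricInChart p.proj z.1)
      (extChartAt 𝓘(ℝ, E).tangent p p) :=
    ContDiffAt.comp (g := metricInChart p.proj) (extChartAt 𝓘(ℝ, E).tangent p p)
      (contDiffAt_metricInChart p.proj) contDiffAt_fst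
  have hs : ContMDiffAt 𝓘(ℝ, E).tangent 𝓘(ℝ, ℝ) ∞ (normSq (E := E) (M := M)) p :=
    (contMDiffAt_iff_contDiffAt_symm _ _ _).2 <| ContDiffAt.congr_of_eventuallyEq
      ((hg.clm_apply contDiffAt_snd).clm_apply contDiffAt_snd) (normSq_extChartAt_symm p)
  refine (mvfderiv_eq_fderiv _ hs _).trans ?_
  rw [(normSq_extChartAt_symm p).fderiv_eq, completeLift_self hX.1]
  refine (fderiv_metric_coordCompleteLift (z := extChartAt 𝓘(ℝ, E).tangent p p)
    ((contDiffAt_metricInChart p.proj).differentiableAt (by simp))).trans ?_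
  exact hX.killingForm_self p.proj _ _

/-- Since the lift is tangent to `SM`, the Lie derivative of the restricted form is computed by
local extensions of the fields to `TM`, where it already vanishes. -/
theorem IsKilling.lieFormVanishesOnSphere_alpha (o : ManifoldOrientation n E M)
    {X : ∀ x : M, TangentSpace 𝓘(ℝ, E) x} (hX : IsKilling X) (i : ℕ) :
    LieFormVanishesOnSphere (completeLift X) (alpha o i) :=
  ⟨fun u _ => hX.tangentToSphere_completeLift u,
    fun u _ Y hY _ => hX.lieFormVanishes_alpha o i u Y hY⟩

end Invariance

end

end TangentLift

open Bundle TangentLift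

theorem theorem5p2 (n : ℕ) {E : Type*} [NormedAddCommGroup E] [NormedSpace ℝ E]
    [FiniteDimensional ℝ E] [Fact (Module.finrank ℝ E = n + 1)]
    {M : Type*} [TopologicalSpace M] [ChartedSpace E M] [IsManifold 𝓘(ℝ, E) ∞ M]
    [RiemannianBundle (fun x : M => TangentSpace 𝓘(ℝ, E) x)]
    [IsContMDiffRiemannianBundle 𝓘(ℝ, E) ∞ E (fun x : M => TangentSpace 𝓘(ℝ, E) x)]
    (o : ManifoldOrientation n E M)
    (X : ∀ x : M, TangentSpace 𝓘(ℝ, E) x) (hX : IsKilling X) :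
    -- all the objects below are smooth on the tangent manifold
    ((∀ p : TangentBundle 𝓘(ℝ, E) M,
        SmoothFieldAt 𝓘(ℝ, E).tangent (completeLift X) p ∧
        SmoothFieldAt 𝓘(ℝ, E).tangent geodesicField p ∧
        SmoothFieldAt 𝓘(ℝ, E).tangent canonicalField p) ∧
      SmoothEndo (N := TangentBundle 𝓘(ℝ, E) M) 𝓘(ℝ, E).tangent
        mirrorAdjoint ∧
      SmoothEndo (N := TangentBundle 𝓘(ℝ, E) M) 𝓘(ℝ, E).tangent mirror ∧
      SmoothForm 𝓘(ℝ, E).tangent (horVol o) ∧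
      SmoothForm 𝓘(ℝ, E).tangent (vertVol o) ∧
      ∀ i ≤ n, SmoothForm 𝓘(ℝ, E).tangent (alpha o i)) ∧
    -- (i)
    (LieEndoVanishes 𝓘(ℝ, E).tangent (completeLift X)
        mirrorAdjoint ∧
      LieEndoVanishes 𝓘(ℝ, E).tangent (completeLift X)
        mirror) ∧
    -- (ii)
    (LieFormVanishes 𝓘(ℝ, E).tangent (completeLift X)
        (horVol o) ∧
      LieFormVanishes 𝓘(ℝ, E).tangent (completeLift X)
        (vertVol o)) ∧
    -- (iii)
    ((∀ p : TangentBundle 𝓘(ℝ, E) M, VectorField.mlieBracket 𝓘(ℝ, E).tangent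
        (completeLift X) geodesicField p = 0) ∧
      (∀ p : TangentBundle 𝓘(ℝ, E) M, VectorField.mlieBracket 𝓘(ℝ, E).tangent
        (completeLift X) canonicalField p = 0)) ∧
    -- (iv), on the tangent manifold and on the unit tangent sphere bundle
    (∀ i ≤ n,
      LieFormVanishes 𝓘(ℝ, E).tangent (completeLift X)
        (alpha o i) ∧
      LieFormVanishesOnSphere (completeLift X)
        (alpha o i)) := by
  refine ⟨⟨fun p => ⟨smoothFieldAt_completeLift hX.1 p,
      smoothEndo_mirrorAdjoint p _ (smoothFieldAt_canonicalField p),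
      smoothFieldAt_canonicalField p⟩, smoothEndo_mirrorAdjoint, smoothEndo_mirror,
      smoothForm_horVol o, smoothForm_vertVol o, fun i _ => smoothForm_alpha o i⟩,
    ⟨hX.lieEndoVanishes_mirrorAdjoint, lieEndoVanishes_mirror hX.1⟩,
    ⟨hX.lieFormVanishes_horVol o, hX.lieFormVanishes_vertVol o⟩,
    ⟨hX.mlieBracket_completeLift_geodesicField, mlieBracket_completeLift_canonicalField hX.1⟩,
    fun i _ => ⟨hX.lieFormVanishes_alpha o i, hX.lieFormVanishesOnSphere_alpha o i⟩⟩
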